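/- Let $\mathfrak n$ be a real $7$-dimensional $2$-step nilpotent Lie algebra, i.e. $\mathfrak n$ is non-abelian and its derived algebra $\mathfrak n'=[\mathfrak n,\mathfrak n]$ is contained in its center. Call $\mathfrak n$ reducible if it is the direct sum of two nonzero ideals, and irreducible otherwise. A $\mathrm G_2$-structure on $\mathfrak n$ is a form $\varphi\in\Lambda^3\mathfrak n^*$ with $(v\lrcorner\varphi)\wedge(v\lrcorner\varphi)\wedge\varphi\neq0$ for all $v\in\mathfrak n\setminus\{0\}$; it induces a unique inner product $g_\varphi$ and orientation on $\mathfrak n$, with volume form $\mathrm{vol}_\varphi$, such that $$g_\varphi(v,w)\,\mathrm{vol}_\varphi=\tfrac16\,(v\lrcorner\varphi)\wedge(w\lrcorner\varphi)\wedge\varphi\qquad\text{for all } v,w\in\mathfrak n .$$ It is coclosed if $d(*_\varphi\varphi)=0$, where $*_\varphi$ is the Hodge operator of $g_\varphi$ and $\mathrm{vol}_\varphi$, and $d$ is the Chevalley--Eilenberg differential of $\mathfrak n$. 1. If $\mathfrak n$ is irreducible and $\dim\mathfrak n'=2$, then $\mathfrak n$ carries no coclosed $\mathrm G_2$-structure.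 2. If $\mathfrak n$ is reducible or $\dim\mathfrak n'\neq2$, then for every inner product $g$ on $\mathfrak n$ there is a coclosed $\mathrm G_2$-structure $\varphi$ on $\mathfrak n$ with $g_\varphi=g$. -/

import Mathlib

noncomputable section

/-- The space `Λᵏ V*` of alternating `k`-forms on a real vector space. -/
abbrev KForm (V : Type*) [AddCommGroup V] [Module ℝ V] (k : ℕ) : Type _ :=
  V [⋀^Fin k]→ₗ[ℝ] ℝ

section LinearAlgebra

variable {V : Type*} [AddCommGroup V] [Module ℝ V]

/-- The wedge product of real-valued alternating forms. It is the sum over `(p, q)`-shuffles, so that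
the wedge product of one-forms `ζ₁, …, ζₖ` evaluated at `v₁, …, vₖ` is `det (ζᵢ (vⱼ))`. -/
def wedge {p q : ℕ} (α : KForm V p) (β : KForm V q) : KForm V (p + q) :=
  ((LinearMap.mul' ℝ ℝ).compAlternatingMap (α.domCoprod β)).domDomCongr finSumFinEquiv

/-- The interior product `v ⌟ α`, that is, `α (v, ·, …, ·)`. -/
def contract {k : ℕ} (v : V) (α : KForm V (k + 1)) : KForm V k :=
  α.curryLeft v

/-- The `7`-form `(v ⌟ φ) ∧ (w ⌟ φ) ∧ φ` attached to a `3`-form `φ`. -/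
def sevenForm (φ : KForm V 3) (v w : V) : KForm V 7 :=
  wedge (wedge (contract v φ) (contract w φ)) φ

/-- A `G₂`-structure on a `7`-dimensional vector space: a `3`-form `φ` such that
`(v ⌟ φ) ∧ (v ⌟ φ) ∧ φ ≠ 0` for every nonzero vector `v`. -/
def IsG2Structure (φ : KForm V 3) : Prop :=
  ∀ v : V, v ≠ 0 → sevenForm φ v v ≠ 0

/-- `g` is an inner product: a symmetric positive definite bilinear form. -/
structure IsInnerProduct (g : LinearMap.BilinForm ℝ V) : Prop where
  symm : ∀ v w, g v w = g w v
  pos : ∀ v, v ≠ 0 → 0 < g v v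

/-- The basis `e` is orthonormal for `g`. -/
def IsOrthonormalBasis (g : LinearMap.BilinForm ℝ V) (e : Module.Basis (Fin 7) ℝ V) : Prop :=
  ∀ i j, g (e i) (e j) = if i = j then 1 else 0

/-- `vol` is the volume form of the inner product `g` for one of the two orientations of the
`7`-dimensional space `V`: it takes the value `1` on some orthonormal basis. -/
def IsVolumeForm (g : LinearMap.BilinForm ℝ V) (vol : KForm V 7) : Prop :=
  ∃ e : Module.Basis (Fin 7) ℝ V, IsOrthonormalBasis g e ∧ vol e = 1

/-- The inner product `g` and the volume form `vol` are those induced by the `G₂`-structure `φ`: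
`g (v, w) vol = (1 / 6) (v ⌟ φ) ∧ (w ⌟ φ) ∧ φ` for all `v, w`, where `vol` is a volume form of `g`.
A given `G₂`-structure determines `g` and `vol` uniquely. -/
structure Induces (φ : KForm V 3) (g : LinearMap.BilinForm ℝ V) (vol : KForm V 7) : Prop where
  inner : IsInnerProduct g
  volume : IsVolumeForm g vol
  metric : ∀ v w, g v w • vol = (1 / 6 : ℝ) • sevenForm φ v w

/-- The expression `∑_{i,j,k} (1 / 3!) φ (eᵢ, eⱼ, eₖ) vol (eᵢ, eⱼ, eₖ, ·, ·, ·, ·)`, which is the Hodge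
dual of the `3`-form `φ` if `e` is an orthonormal basis and `vol` a volume form of the metric. -/
def starExpr (vol : KForm V 7) (e : Module.Basis (Fin 7) ℝ V) (φ : KForm V 3) : KForm V 4 :=
  ∑ i, ∑ j, ∑ k, ((1 / 6 : ℝ) * φ ![e i, e j, e k]) •
    contract (e k) (contract (e j) (contract (e i) vol))

/-- The `4`-form `ψ` is the Hodge dual `* φ` of the `3`-form `φ` for the inner product `g` and
the volume form `vol`. The right-hand side is the same for all orthonormal bases. -/
def IsHodgeDual (g : LinearMap.BilinForm ℝ V) (vol : KForm V 7) (φ : KForm V 3)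
    (ψ : KForm V 4) : Prop :=
  ∀ e : Module.Basis (Fin 7) ℝ V, IsOrthonormalBasis g e → ψ = starExpr vol e φ

end LinearAlgebra

section LieAlgebra

variable {L : Type*} [LieRing L] [LieAlgebra ℝ L]

/-- The Chevalley–Eilenberg differential with trivial coefficients:
`dα (x₀, …, xₖ₊₁) = ∑_{i < j} (-1)^(i + j) α ([xᵢ, xⱼ], x₀, …, x̂ᵢ, …, x̂ⱼ, …, xₖ₊₁)`.
(For `i < j` the list with `xᵢ, xⱼ` omitted is obtained by omitting the entry `j`, then `i`.) -/
def ceDifferential {k : ℕ} (α : KForm L (k + 1)) (x : Fin (k + 2) → L) : ℝ :=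
  ∑ j : Fin (k + 2), ∑ i : Fin (k + 1),
    if i.castSucc < j then
      (-1 : ℝ) ^ ((i : ℕ) + (j : ℕ)) *
        α (Fin.cons ⁅x i.castSucc, x j⁆ fun m : Fin k => x (j.succAbove (i.succAbove m)))
    else 0

/-- `φ` is a coclosed `G₂`-structure on the Lie algebra: `d (* φ) = 0`, where the Hodge star is that of
the inner product and the orientation induced by `φ`. -/
def IsCoclosedG2Structure (φ : KForm L 3) : Prop :=
  IsG2Structure φ ∧
    ∃ (g : LinearMap.BilinForm ℝ L) (vol : KForm L 7) (ψ : KForm L 4),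
      Induces φ g vol ∧ IsHodgeDual g vol φ ψ ∧ ∀ x, ceDifferential ψ x = 0

/-- The inner product `g` is the metric induced by the `3`-form `φ`. -/
def IsInducedMetric (φ : KForm L 3) (g : LinearMap.BilinForm ℝ L) : Prop :=
  ∃ vol : KForm L 7, Induces φ g vol

variable (L)

/-- The derived algebra `[L, L]`. -/
def derivedAlgebra : LieIdeal ℝ L :=
  ⁅(⊤ : LieIdeal ℝ L), (⊤ : LieIdeal ℝ L)⁆

/-- Two-step nilpotent: not abelian, with derived algebra contained in the center. -/
def IsTwoStepNilpotent : Prop :=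
  ¬ IsLieAbelian L ∧ derivedAlgebra L ≤ LieAlgebra.center ℝ L

/-- Reducible (decomposable): the direct sum of two nonzero ideals. -/
def IsReducibleLie : Prop :=
  ∃ I J : LieIdeal ℝ L, I ≠ ⊥ ∧ J ≠ ⊥ ∧ IsCompl I J

end LieAlgebra

end

/-! Everything reduces to the symmetry of a matrix. Take a `g`-orthonormal basis `b` with structure
constants `cᵃᵢⱼ` satisfying `cⁱᵢⱼ = 0`, and put `S a c = ∑ᵢⱼ cᵃᵢⱼ φ (b_c, bᵢ, bⱼ)` (`structureSum`).
Evaluating `d (* φ)` on the five basis vectors other than `b_a`, `b_c` gives `S a c - S c a` up to a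
nonzero factor, so `φ` is coclosed exactly when `S` is symmetric (`ceDifferential_eq_zero_iff`). If
a central subspace `C` contains `n'` and `b` is adapted to `C`, then `cⁱᵢⱼ = 0` holds and all rows
of `S` outside `C` vanish.

Obstruction (`exists_central_of_coclosed`). Let `dim n' = 2`. Complete an orthonormal basis `b₀, b₁`
of `n'` by a `b₂` that makes an associative 3-plane, so that `φ` vanishes on the span of `b₃, …,
b₆`. Symmetry forces `S a c = 0` for `c ≥ 3`, and nondegeneracy of `φ` then gives `[b₂, ·] = 0`. A
central vector outside `n'` splits off as a direct summand, so the algebra is reducible.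

Existence. The standard form of any orthonormal basis induces `g`, so only the basis has to be
chosen. If `dim C = 3`, rotating the basis of `C` multiplies the only nonzero block of `S` by an
orthogonal matrix, which can be chosen to make it symmetric (`exists_coclosed_of_central_three`). If
`dim C = 1`, rotating the complement of `C` makes the bracket commute with the complex structure `b₀
⌟ φ`, which kills the off-diagonal entries of `S` (`exists_coclosed_of_central_one`). These cases
suffice: `1 ≤ dim n' ≤ 3`, and a reducible algebra with `dim n' = 2` has a central vector outside
`n'`, which enlarges `n'` to a three-dimensional `C`. -/

open Equiv Equiv.Perm

/-! ### Wedge products as sums over explicit coset representatives. -/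

section Wedge
variable {V : Type*} [AddCommGroup V] [Module ℝ V]

/-- The wedge is a sum over a quotient of permutations, and the summand does not depend on the
representative. Any explicit transversal `τ` therefore turns it into a finite sum that can be
computed. -/
theorem wedge_apply_eq_sum {p q : ℕ} {ι : Type*} [Fintype ι] (τ : ι → Perm (Fin p ⊕ Fin q))
    (hτ : Function.Bijective fun i => (Quotient.mk'' (τ i) : ModSumCongr (Fin p) (Fin q)))
    (α : KForm V p) (β : KForm V q) (x : Fin (p + q) → V) :
    wedge α β x = ∑ i, ((sign (τ i) : ℤ) : ℝ) *
      (α (fun k => x (finSumFinEquiv (τ i (Sum.inl k)))) *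
        β (fun k => x (finSumFinEquiv (τ i (Sum.inr k))))) := by
  have h : wedge α β x = ∑ σ : ModSumCongr (Fin p) (Fin q), LinearMap.mul' ℝ ℝ
      (AlternatingMap.domCoprod.summand α β σ fun k => x (finSumFinEquiv k)) := by
    rw [← map_sum]
    simp [wedge, AlternatingMap.domCoprod_apply, Function.comp_def]
  rw [h]
  refine (Fintype.sum_bijective _ hτ _ _ fun i => ?_).symm
  rw [AlternatingMap.domCoprod.summand_mk'']
  rcases Int.units_eq_one_or (sign (τ i)) with hs | hs <;> rw [hs] <;>
    simp [MultilinearMap.domCoprod_apply]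

/-- A coset modulo block permutations is determined by the set to which the second block is sent,
and the number of cosets is `(p + q)! / (p! q!)`. Injectivity and a count suffice, and both are
decidable for concrete `τ`. -/
theorem bijective_mk_modSumCongr {p q : ℕ} {ι : Type*} [Fintype ι]
    (τ : ι → Perm (Fin p ⊕ Fin q))
    (hcard : Fintype.card ι * (p.factorial * q.factorial) = (p + q).factorial)
    (hinj : ∀ i j, (∀ k, ∃ l, τ j (Sum.inr k) = τ i (Sum.inr l)) → i = j) :
    Function.Bijective fun i => (Quotient.mk'' (τ i) : ModSumCongr (Fin p) (Fin q)) := by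
  classical
  rw [Fintype.bijective_iff_injective_and_card]
  constructor
  · intro i j hij
    apply hinj
    intro k
    have h : (τ i)⁻¹ * τ j ∈ (sumCongrHom (Fin p) (Fin q)).range := by
      have := Quotient.exact' hij
      rwa [QuotientGroup.leftRel_apply] at this
    obtain ⟨⟨l, r⟩, hlr⟩ := h
    refine ⟨r k, ?_⟩
    have h2 := congrArg (fun σ => (τ i * σ) (Sum.inr k)) hlr
    simpa using h2.symm
  · have h := (sumCongrHom (Fin p) (Fin q)).range.card_eq_card_quotient_mul_card_subgroup
    rw [Nat.card_congr (MonoidHom.ofInjective sumCongrHom_injective).symm.toEquiv] at h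
    simp only [Nat.card_eq_fintype_card, Fintype.card_prod, Fintype.card_perm, Fintype.card_sum,
      Fintype.card_fin] at h
    rw [← hcard] at h
    exact Nat.eq_of_mul_eq_mul_right (by positivity) h

/-- The permutation of `Fin 4` that moves the last two entries to `a < b`. -/
def shuffleTwoTwo (t : Fin 4 × Fin 4) : Perm (Fin 2 ⊕ Fin 2) :=
  swap (Sum.inr 1) (finSumFinEquiv.symm t.2) * swap (Sum.inr 0) (finSumFinEquiv.symm t.1)

theorem sum_subtype_ite {ι : Type*} [Fintype ι] (P : ι → Prop) [DecidablePred P] (F : ι → ℝ) :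
    ∑ i : {i // P i}, F i = ∑ i, if P i then F i else 0 := by
  rw [← Finset.sum_filter]
  exact (Finset.sum_subtype (p := P) _ (by simp) F).symm

theorem wedge_apply_two_two (α β : KForm V 2) (x : Fin 4 → V) :
    wedge α β x = ∑ t : Fin 4 × Fin 4, if t.1 < t.2 then ((sign (shuffleTwoTwo t) : ℤ) : ℝ) *
      (α (fun k => x (finSumFinEquiv (shuffleTwoTwo t (Sum.inl k)))) *
        β (fun k => x (finSumFinEquiv (shuffleTwoTwo t (Sum.inr k))))) else 0 := by
  rw [← sum_subtype_ite (fun t : Fin 4 × Fin 4 => t.1 < t.2)]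
  refine wedge_apply_eq_sum (fun t : {t : Fin 4 × Fin 4 // t.1 < t.2} => shuffleTwoTwo t)
    (bijective_mk_modSumCongr _ (by decide +kernel) (by decide +kernel)) α β x

/-- The permutation of `Fin 7` that moves the last three entries to `a < b < c`. -/
def shuffleFourThree (t : Fin 7 × Fin 7 × Fin 7) : Perm (Fin 4 ⊕ Fin 3) :=
  swap (Sum.inr 2) (finSumFinEquiv.symm t.2.2) * swap (Sum.inr 1) (finSumFinEquiv.symm t.2.1) *
    swap (Sum.inr 0) (finSumFinEquiv.symm t.1)

theorem wedge_apply_four_three (α : KForm V 4) (β : KForm V 3) (x : Fin 7 → V) :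
    wedge α β x = ∑ t : Fin 7 × Fin 7 × Fin 7, if t.1 < t.2.1 ∧ t.2.1 < t.2.2 then
      ((sign (shuffleFourThree t) : ℤ) : ℝ) *
      (α (fun k => x (finSumFinEquiv (shuffleFourThree t (Sum.inl k)))) *
        β (fun k => x (finSumFinEquiv (shuffleFourThree t (Sum.inr k))))) else 0 := by
  rw [← sum_subtype_ite (fun t : Fin 7 × Fin 7 × Fin 7 => t.1 < t.2.1 ∧ t.2.1 < t.2.2)]
  refine wedge_apply_eq_sum (fun t : {t : Fin 7 × Fin 7 × Fin 7 // t.1 < t.2.1 ∧ t.2.1 < t.2.2} =>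
    shuffleFourThree t) (bijective_mk_modSumCongr _ (by decide +kernel) (by decide +kernel)) α β x

/-- The ten `(2, 3)`-shuffles. -/
def shuffleTwoThree : Fin 10 → Perm (Fin 5) :=
  ![1, swap 1 2, swap 2 3 * swap 1 2, swap 3 4 * swap 2 3 * swap 1 2, swap 0 1 * swap 1 2,
    swap 0 1 * swap 2 3 * swap 1 2, swap 0 1 * swap 3 4 * swap 2 3 * swap 1 2,
    swap 1 2 * swap 0 1 * swap 2 3 * swap 1 2, swap 1 2 * swap 0 1 * swap 3 4 * swap 2 3 * swap 1 2,
    swap 2 3 * swap 1 2 * swap 0 1 * swap 3 4 * swap 2 3 * swap 1 2]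

theorem wedge_apply_two_three (α : KForm V 2) (β : KForm V 3) (x : Fin 5 → V) :
    wedge α β x = ∑ i, ((sign (shuffleTwoThree i) : ℤ) : ℝ) *
      (α ![x (shuffleTwoThree i 0), x (shuffleTwoThree i 1)] *
        β ![x (shuffleTwoThree i 2), x (shuffleTwoThree i 3), x (shuffleTwoThree i 4)]) := by
  have h := wedge_apply_eq_sum
    (fun i => (finSumFinEquiv (m := 2) (n := 3)).trans
      ((shuffleTwoThree i).trans (finSumFinEquiv (m := 2) (n := 3)).symm))
    (bijective_mk_modSumCongr _ (by decide +kernel) (by decide +kernel)) α β x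
  rw [h]
  refine Finset.sum_congr rfl fun i _ => ?_
  have hs : sign ((finSumFinEquiv (m := 2) (n := 3)).trans
      ((shuffleTwoThree i).trans (finSumFinEquiv (m := 2) (n := 3)).symm)) =
      sign (shuffleTwoThree i) := by
    rw [← Equiv.trans_assoc]
    exact sign_trans_trans_symm (shuffleTwoThree i) (finSumFinEquiv (m := 2) (n := 3))
  have h1 : (fun k : Fin 2 => x (finSumFinEquiv ((finSumFinEquiv (m := 2) (n := 3)).trans
      ((shuffleTwoThree i).trans (finSumFinEquiv (m := 2) (n := 3)).symm) (Sum.inl k)))) =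
      ![x (shuffleTwoThree i 0), x (shuffleTwoThree i 1)] := by
    ext k
    rw [Equiv.trans_apply, Equiv.trans_apply, Equiv.apply_symm_apply]
    fin_cases k <;> rfl
  have h2 : (fun k : Fin 3 => x (finSumFinEquiv ((finSumFinEquiv (m := 2) (n := 3)).trans
      ((shuffleTwoThree i).trans (finSumFinEquiv (m := 2) (n := 3)).symm) (Sum.inr k)))) =
      ![x (shuffleTwoThree i 2), x (shuffleTwoThree i 3), x (shuffleTwoThree i 4)] := by
    ext k
    rw [Equiv.trans_apply, Equiv.trans_apply, Equiv.apply_symm_apply]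
    fin_cases k <;> rfl
  rw [hs, h1, h2]

end Wedge

/-! ### The standard G₂-form and its 7-forms in coordinates. -/

section Wedge
variable {V : Type*} [AddCommGroup V] [Module ℝ V]

theorem wedge_add_left {p q : ℕ} (α α' : KForm V p) (β : KForm V q) :
    wedge (α + α') β = wedge α β + wedge α' β := by
  ext x
  simp only [wedge, ← AlternatingMap.domCoprod'_apply, TensorProduct.add_tmul, map_add]
  simp

theorem wedge_smul_left {p q : ℕ} (c : ℝ) (α : KForm V p) (β : KForm V q) :
    wedge (c • α) β = c • wedge α β := by
  ext x
  simp only [wedge, ← AlternatingMap.domCoprod'_apply, ← TensorProduct.smul_tmul', map_smul]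
  simp

theorem wedge_add_right {p q : ℕ} (α : KForm V p) (β β' : KForm V q) :
    wedge α (β + β') = wedge α β + wedge α β' := by
  ext x
  simp only [wedge, ← AlternatingMap.domCoprod'_apply, TensorProduct.tmul_add, map_add]
  simp

theorem wedge_smul_right {p q : ℕ} (c : ℝ) (α : KForm V p) (β : KForm V q) :
    wedge α (c • β) = c • wedge α β := by
  ext x
  simp only [wedge, ← AlternatingMap.domCoprod'_apply, TensorProduct.tmul_smul, map_smul]
  simp

theorem contract_add {k : ℕ} (v w : V) (α : KForm V (k + 1)) :
    contract (v + w) α = contract v α + contract w α := by simp [contract]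

theorem contract_smul {k : ℕ} (c : ℝ) (v : V) (α : KForm V (k + 1)) :
    contract (c • v) α = c • contract v α := by simp [contract]

/-- The `7`-form `sevenForm φ v w` as a bilinear map in `v` and `w`. -/
noncomputable def sevenFormBilin (φ : KForm V 3) : V →ₗ[ℝ] V →ₗ[ℝ] KForm V 7 :=
  LinearMap.mk₂ ℝ (sevenForm φ)
    (fun _ _ _ => by simp only [sevenForm, contract_add, wedge_add_left])
    (fun _ _ _ => by simp only [sevenForm, contract_smul, wedge_smul_left])
    (fun _ _ _ => by simp only [sevenForm, contract_add, wedge_add_left, wedge_add_right])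
    (fun _ _ _ => by simp only [sevenForm, contract_smul, wedge_smul_left, wedge_smul_right])

theorem KForm.sum_apply {k : ℕ} {ι : Type*} (s : Finset ι) (α : ι → KForm V k) (x : Fin k → V) :
    (∑ i ∈ s, α i) x = ∑ i ∈ s, α i x := by
  induction s using Finset.cons_induction with
  | empty => simp
  | cons a s h ih => rw [Finset.sum_cons, Finset.sum_cons, AlternatingMap.add_apply, ih]

/-- The seven lines of the Fano plane, ordered so that they support the standard `G₂`-form. -/
def fanoLine : Fin 7 → Fin 3 → Fin 7 :=
  ![![0, 1, 2], ![0, 3, 4], ![0, 5, 6], ![1, 3, 5], ![1, 4, 6], ![2, 3, 6], ![2, 4, 5]]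

/-- The signs with which the lines of the Fano plane enter the standard `G₂`-form. -/
def fanoSign : Fin 7 → ℤ := ![1, 1, 1, 1, -1, -1, -1]

/-- The standard `G₂`-form with respect to a basis. -/
noncomputable def stdForm (e : Module.Basis (Fin 7) ℝ V) : KForm V 3 :=
  ∑ l, (fanoSign l : ℝ) • (Matrix.detRowAlternating (R := ℝ) (n := Fin 3)).compLinearMap
    (LinearMap.pi fun j => e.coord (fanoLine l j))

/-- The coefficients of the standard `G₂`-form. -/
def stdCoeff (a b c : Fin 7) : ℤ :=
  if (a.val + 1) ^^^ (b.val + 1) = c.val + 1 then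
    (![![0, 1, -1, 1, -1, 1, -1], ![-1, 0, 1, 1, -1, -1, 1], ![1, -1, 0, -1, -1, 1, 1],
      ![-1, -1, 1, 0, 1, 1, -1], ![1, 1, 1, -1, 0, -1, -1], ![-1, 1, -1, -1, 1, 0, 1],
      ![1, -1, -1, 1, 1, -1, 0]] : Fin 7 → Fin 7 → ℤ) a b else 0

/-- The labels plus one, written in binary, are the nonzero vectors of `𝔽₂³`, and the lines are the
triples with XOR zero. The sign table orients them. Integer coefficients keep this check, and the
one in `stdSeven_eq`, within reach of kernel evaluation. -/
theorem sum_det_fanoLine (a b c : Fin 7) :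
    ∑ l, fanoSign l * (Matrix.of fun i j => if fanoLine l j = ![a, b, c] i then (1 : ℤ) else 0).det
      = stdCoeff a b c := by
  simp only [Matrix.det_fin_three]
  revert a b c
  decide +kernel

theorem stdForm_apply_basis (e : Module.Basis (Fin 7) ℝ V) (s : Fin 3 → Fin 7) :
    stdForm e (fun k => e (s k)) = stdCoeff (s 0) (s 1) (s 2) := by
  rw [← sum_det_fanoLine]
  have hs : ![s 0, s 1, s 2] = s := by ext i; fin_cases i <;> rfl
  simp only [stdForm, hs]
  push_cast
  rw [KForm.sum_apply]
  refine Finset.sum_congr rfl fun l _ => ?_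
  rw [AlternatingMap.smul_apply, smul_eq_mul]
  congr 1
  rw [AlternatingMap.compLinearMap_apply]
  refine congrArg Matrix.det ?_
  ext i j
  simp [Finsupp.single_apply, Matrix.of_apply, eq_comm]

/-- The coefficients of the `4`-form `(eᵢ ⌟ φ) ∧ (eⱼ ⌟ φ)`, for the standard `G₂`-form `φ`. -/
def stdWedge (i j : Fin 7) (s : Fin 4 → Fin 7) : ℤ :=
  ∑ t : Fin 4 × Fin 4, if t.1 < t.2 then (sign (shuffleTwoTwo t) : ℤ) *
    (stdCoeff i (s (finSumFinEquiv (shuffleTwoTwo t (Sum.inl 0))))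
        (s (finSumFinEquiv (shuffleTwoTwo t (Sum.inl 1)))) *
      stdCoeff j (s (finSumFinEquiv (shuffleTwoTwo t (Sum.inr 0))))
        (s (finSumFinEquiv (shuffleTwoTwo t (Sum.inr 1))))) else 0

/-- The coefficient of the `7`-form `(eᵢ ⌟ φ) ∧ (eⱼ ⌟ φ) ∧ φ`, for the standard `G₂`-form `φ`. -/
def stdSeven (i j : Fin 7) : ℤ :=
  ∑ t : Fin 7 × Fin 7 × Fin 7, if t.1 < t.2.1 ∧ t.2.1 < t.2.2 then
    (sign (shuffleFourThree t) : ℤ) *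
      (stdWedge i j (fun k => finSumFinEquiv (shuffleFourThree t (Sum.inl k))) *
        stdCoeff (finSumFinEquiv (shuffleFourThree t (Sum.inr 0)))
          (finSumFinEquiv (shuffleFourThree t (Sum.inr 1)))
          (finSumFinEquiv (shuffleFourThree t (Sum.inr 2)))) else 0

theorem contract_stdForm_apply (e : Module.Basis (Fin 7) ℝ V) (i : Fin 7) (s : Fin 2 → Fin 7) :
    contract (e i) (stdForm e) (fun k => e (s k)) = stdCoeff i (s 0) (s 1) := by
  refine Eq.trans ?_ (stdForm_apply_basis e ![i, s 0, s 1])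
  change stdForm e _ = _
  congr 1
  ext k
  fin_cases k <;> rfl

theorem wedge_contract_stdForm_apply (e : Module.Basis (Fin 7) ℝ V) (i j : Fin 7)
    (s : Fin 4 → Fin 7) :
    wedge (contract (e i) (stdForm e)) (contract (e j) (stdForm e)) (fun k => e (s k)) =
      stdWedge i j s := by
  rw [wedge_apply_two_two, stdWedge, Int.cast_sum]
  refine Finset.sum_congr rfl fun t _ => ?_
  split_ifs
  · rw [contract_stdForm_apply e i fun k => s (finSumFinEquiv (shuffleTwoTwo t (Sum.inl k))),
      contract_stdForm_apply e j fun k => s (finSumFinEquiv (shuffleTwoTwo t (Sum.inr k)))]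
    push_cast
    rfl
  · simp

theorem sevenForm_stdForm_apply (e : Module.Basis (Fin 7) ℝ V) (i j : Fin 7) :
    sevenForm (stdForm e) (e i) (e j) e = stdSeven i j := by
  rw [sevenForm, wedge_apply_four_three, stdSeven, Int.cast_sum]
  refine Finset.sum_congr rfl fun t _ => ?_
  split_ifs
  · rw [wedge_contract_stdForm_apply e i j
        fun k => finSumFinEquiv (shuffleFourThree t (Sum.inl k)),
      stdForm_apply_basis e fun k => finSumFinEquiv (shuffleFourThree t (Sum.inr k))]
    push_cast
    rfl
  · simp

/-- This finite computation says that the standard form induces the metric in which its basis is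
orthonormal; the `6` cancels the normalisation `1 / 6`. -/
theorem stdSeven_eq (i j : Fin 7) : stdSeven i j = if i = j then 6 else 0 := by
  revert i j
  decide +kernel

end Wedge

/-! ### The induced metric, and independence of the Hodge dual from the orthonormal basis. -/

section Metric
variable {V : Type*} [AddCommGroup V] [Module ℝ V]

theorem IsOrthonormalBasis.repr_eq {g : LinearMap.BilinForm ℝ V} {e : Module.Basis (Fin 7) ℝ V}
    (he : IsOrthonormalBasis g e) (v : V) (i : Fin 7) : e.repr v i = g v (e i) := by
  conv_rhs => rw [← e.sum_repr v]
  simp only [map_sum, map_smul, LinearMap.sum_apply, LinearMap.smul_apply, he _ i]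
  simp

theorem IsOrthonormalBasis.sum_smul {g : LinearMap.BilinForm ℝ V} {e : Module.Basis (Fin 7) ℝ V}
    (he : IsOrthonormalBasis g e) (v : V) : ∑ i, g v (e i) • e i = v := by
  simp only [← he.repr_eq]
  exact e.sum_repr v

theorem IsOrthonormalBasis.reindex {g : LinearMap.BilinForm ℝ V} {e : Module.Basis (Fin 7) ℝ V}
    (he : IsOrthonormalBasis g e) (σ : Perm (Fin 7)) : IsOrthonormalBasis g (e.reindex σ) := by
  intro i j
  simp [he _ _]

/-- The sum is the metric trace of `B`: two orthonormal bases differ by an orthogonal matrix, whose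
columns are orthonormal (`hsum`). -/
theorem IsOrthonormalBasis.sum_bilin_eq {M : Type*} [AddCommGroup M] [Module ℝ M]
    {g : LinearMap.BilinForm ℝ V} (hg : IsInnerProduct g) {e e' : Module.Basis (Fin 7) ℝ V}
    (he : IsOrthonormalBasis g e) (he' : IsOrthonormalBasis g e') (B : V →ₗ[ℝ] V →ₗ[ℝ] M) :
    ∑ i, B (e i) (e i) = ∑ i, B (e' i) (e' i) := by
  have hsum : ∀ j k, ∑ i, g (e i) (e' j) * g (e i) (e' k) = g (e' j) (e' k) := by
    intro j k
    conv_rhs => rw [← he.sum_smul (e' j)]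
    simp only [map_sum, map_smul, LinearMap.sum_apply, LinearMap.smul_apply, smul_eq_mul]
    simp only [hg.symm (e' j)]
  calc ∑ i, B (e i) (e i)
      = ∑ i, ∑ j, ∑ k, (g (e i) (e' j) * g (e i) (e' k)) • B (e' j) (e' k) := by
        refine Finset.sum_congr rfl fun i _ => ?_
        have h : B (e i) (e i) = B (∑ j, g (e i) (e' j) • e' j) (∑ j, g (e i) (e' j) • e' j) := by
          rw [he'.sum_smul]
        rw [h]
        simp only [map_sum, map_smul, LinearMap.sum_apply, LinearMap.smul_apply, Finset.smul_sum,
          smul_smul]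
        rw [Finset.sum_comm]
        simp only [mul_comm]
    _ = ∑ j, ∑ k, (∑ i, g (e i) (e' j) * g (e i) (e' k)) • B (e' j) (e' k) := by
        rw [Finset.sum_comm]
        refine Finset.sum_congr rfl fun j _ => ?_
        rw [Finset.sum_comm]
        simp only [Finset.sum_smul]
    _ = ∑ i, B (e' i) (e' i) := by
        simp only [hsum]
        simp [he' _ _]

theorem KForm.eq_of_apply_basis {α β : KForm V 7} (e : Module.Basis (Fin 7) ℝ V)
    (h : α e = β e) : α = β := by
  rw [α.eq_smul_basis_det e, β.eq_smul_basis_det e, h]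

/-- Both sides are bilinear with values in the one-dimensional space of 7-forms, so it is enough to
compare them on pairs of basis vectors and evaluate at `e`. -/
theorem Induces.of_stdForm {g : LinearMap.BilinForm ℝ V} (hg : IsInnerProduct g)
    {e : Module.Basis (Fin 7) ℝ V} (he : IsOrthonormalBasis g e) :
    Induces (stdForm e) g e.det where
  inner := hg
  volume := ⟨e, he, e.det_self⟩
  metric := by
    have h : g.compr₂ (LinearMap.toSpanSingleton ℝ (KForm V 7) e.det) =
        (1 / 6 : ℝ) • sevenFormBilin (stdForm e) := by
      refine LinearMap.ext_basis e e fun i j => KForm.eq_of_apply_basis e ?_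
      have h1 : sevenForm (stdForm e) (e i) (e j) e = ((if i = j then 6 else 0 : ℤ) : ℝ) :=
        (sevenForm_stdForm_apply e i j).trans (congrArg _ (stdSeven_eq i j))
      have h2 : sevenFormBilin (stdForm e) (e i) (e j) = sevenForm (stdForm e) (e i) (e j) := rfl
      rw [LinearMap.compr₂_apply, LinearMap.toSpanSingleton_apply, LinearMap.smul_apply,
        LinearMap.smul_apply, h2, AlternatingMap.smul_apply]
      refine Eq.trans ?_ (congrArg ((1 / 6 : ℝ) • ·) h1).symm
      rw [he i j, e.det_self]
      split_ifs <;> norm_num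
    exact fun v w => congrArg (fun B => B v w) h

theorem Induces.isG2Structure {φ : KForm V 3} {g : LinearMap.BilinForm ℝ V} {vol : KForm V 7}
    (h : Induces φ g vol) : IsG2Structure φ := by
  intro v hv h0
  obtain ⟨e, -, he⟩ := h.volume
  have h1 := congrArg (fun α : KForm V 7 => α e) (h.metric v v)
  simp [h0, he] at h1
  exact (h.inner.pos v hv).ne' h1

theorem contract_add_right {k : ℕ} (v : V) (α β : KForm V (k + 1)) :
    contract v (α + β) = contract v α + contract v β := by simp [contract]

theorem contract_smul_right {k : ℕ} (c : ℝ) (v : V) (α : KForm V (k + 1)) :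
    contract v (c • α) = c • contract v α := by simp [contract]

theorem contract_apply {k : ℕ} (v : V) (α : KForm V (k + 1)) (x : Fin k → V) :
    contract v α x = α (Matrix.vecCons v x) := rfl

theorem contract_swap {k : ℕ} (v w : V) (α : KForm V (k + 2)) :
    contract v (contract w α) = - contract w (contract v α) := by
  ext x
  rw [AlternatingMap.neg_apply, contract_apply, contract_apply, contract_apply, contract_apply,
    ← α.map_swap _ (zero_ne_one (α := Fin (k + 2)))]
  congr 1
  ext i
  refine Fin.cases ?_ (fun i => Fin.cases ?_ (fun i => ?_) i) i
  · simp
  · simp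
  · rw [Function.comp_apply, swap_apply_of_ne_of_ne (by simp [Fin.ext_iff]) (by simp [Fin.ext_iff])]
    simp

/-- The summand of `starExpr`. -/
noncomputable def starTerm (vol : KForm V 7) (φ : KForm V 3) (u v w : V) : KForm V 4 :=
  ((1 / 6 : ℝ) * φ ![u, v, w]) • contract w (contract v (contract u vol))

/-- The sign from `φ` cancels the sign from contracting `vol`. -/
theorem starTerm_swap_left (vol : KForm V 7) (φ : KForm V 3) (u v w : V) :
    starTerm vol φ u v w = starTerm vol φ v u w := by
  have h : φ ![u, v, w] = - φ ![v, u, w] := congrArg (fun α => α ![w]) (contract_swap v u φ)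
  have h' : ∀ α : KForm V 5, contract w (-α) = -contract w α := fun α => by
    ext x
    rfl
  rw [starTerm, starTerm, h, contract_swap v u vol, h']
  simp

theorem starTerm_swap_right (vol : KForm V 7) (φ : KForm V 3) (u v w : V) :
    starTerm vol φ u v w = starTerm vol φ u w v := by
  have h : φ ![u, v, w] = - φ ![u, w, v] :=
    congrArg (fun α => α ![]) (contract_swap w v (contract u φ))
  rw [starTerm, starTerm, h, contract_swap w v]
  simp

theorem sum_starTerm_eq {g : LinearMap.BilinForm ℝ V} (hg : IsInnerProduct g)
    {e e' : Module.Basis (Fin 7) ℝ V} (he : IsOrthonormalBasis g e) (he' : IsOrthonormalBasis g e')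
    (vol : KForm V 7) (φ : KForm V 3) (u w : V) :
    ∑ i, starTerm vol φ (e i) u w = ∑ i, starTerm vol φ (e' i) u w := by
  refine he.sum_bilin_eq hg he' (LinearMap.mk₂ ℝ
    (fun x y => ((1 / 6 : ℝ) * contract w (contract u (contract x φ)) ![]) •
      contract w (contract u (contract y vol))) ?_ ?_ ?_ ?_)
  · intros
    simp only [contract_add, contract_add_right, AlternatingMap.add_apply, mul_add, add_smul]
  · intros
    simp only [contract_smul, contract_smul_right, AlternatingMap.smul_apply, smul_smul,
      smul_eq_mul, mul_left_comm]
  · intros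
    simp only [contract_add, contract_add_right, smul_add]
  · intro c x y
    simp only [contract_smul, contract_smul_right]
    rw [smul_comm]

theorem starExpr_eq {g : LinearMap.BilinForm ℝ V} (hg : IsInnerProduct g)
    {e e' : Module.Basis (Fin 7) ℝ V} (he : IsOrthonormalBasis g e) (he' : IsOrthonormalBasis g e')
    (vol : KForm V 7) (φ : KForm V 3) : starExpr vol e φ = starExpr vol e' φ := by
  let S := fun a b c : Fin 7 → V => ∑ i, ∑ j, ∑ k, starTerm vol φ (a i) (b j) (c k)
  have hl : ∀ a b c, S a b c = S b a c := by
    intro a b c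
    refine Finset.sum_comm.trans ?_
    simp only [S, starTerm_swap_left vol φ (a _) (b _)]
  have hr : ∀ a b c, S a b c = S a c b := by
    intro a b c
    refine Finset.sum_congr rfl fun i _ => Finset.sum_comm.trans ?_
    simp only [starTerm_swap_right vol φ _ (b _) (c _)]
  have h : ∀ b c, S e b c = S e' b c := by
    intro b c
    have hS : ∀ a, S a b c = ∑ j, ∑ k, ∑ i, starTerm vol φ (a i) (b j) (c k) := fun a =>
      Finset.sum_comm.trans (Finset.sum_congr rfl fun j _ => Finset.sum_comm)
    rw [hS, hS]
    exact Finset.sum_congr rfl fun j _ => Finset.sum_congr rfl fun k _ =>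
      sum_starTerm_eq hg he he' vol φ _ _
  change S e e e = S e' e' e'
  -- Only the first slot can be exchanged directly; the symmetries `hl` and `hr` bring each
  -- remaining `e` there.
  rw [h, hl, h, hr, hl, h, hl]

theorem IsHodgeDual.of_starExpr {g : LinearMap.BilinForm ℝ V} (hg : IsInnerProduct g)
    {e : Module.Basis (Fin 7) ℝ V} (he : IsOrthonormalBasis g e)
    (vol : KForm V 7) (φ : KForm V 3) : IsHodgeDual g vol φ (starExpr vol e φ) :=
  fun _ he' => starExpr_eq hg he he' vol φ

theorem KForm.map_perm_basis {k : ℕ} (α : KForm V k) (v : Fin k → V) (σ : Perm (Fin k)) :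
    α (fun i => v (σ i)) = ((sign σ : ℤ) : ℝ) * α v := by
  have h := α.map_perm v σ
  rw [Units.smul_def, zsmul_eq_mul] at h
  exact h

theorem sum_ite_eq_cast_mul {ι : Type*} [Fintype ι] (P : ι → ι → ι → Prop)
    [∀ i j k, Decidable (P i j k)] (c : ℝ) : (∑ i, ∑ j, ∑ k, if P i j k then c else 0) =
      ((∑ i, ∑ j, ∑ k, if P i j k then 1 else 0 : ℕ) : ℝ) * c := by
  push_cast
  simp only [Finset.sum_mul, ite_mul, one_mul, zero_mul]

/-- Only triples that permute `0, 1, 2` avoid a repeated argument of `vol`. There are six of them,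
with equal contributions, which cancels the factor `1 / 6`. -/
theorem starExpr_apply_basis (vol : KForm V 7) (φ : KForm V 3) (b : Module.Basis (Fin 7) ℝ V) :
    starExpr vol b φ ![b 3, b 4, b 5, b 6] = vol b * φ ![b 0, b 1, b 2] := by
  have hT : ∀ i j k, starTerm vol φ (b i) (b j) (b k) ![b 3, b 4, b 5, b 6] =
      if Function.Injective ![i, j, k, 3, 4, 5, 6] then
        starTerm vol φ (b 0) (b 1) (b 2) ![b 3, b 4, b 5, b 6] else 0 := by
    intro i j k
    split_ifs with h
    · have : ∀ i j k : Fin 7, Function.Injective ![i, j, k, 3, 4, 5, 6] →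
        (i, j, k) ∈ [((0 : Fin 7), (1 : Fin 7), (2 : Fin 7)), (0, 2, 1), (1, 0, 2), (1, 2, 0),
          (2, 0, 1), (2, 1, 0)] := by decide +kernel
      have := this i j k h
      simp only [List.mem_cons, Prod.mk.injEq, List.not_mem_nil, or_false] at this
      rcases this with ⟨rfl, rfl, rfl⟩ | ⟨rfl, rfl, rfl⟩ | ⟨rfl, rfl, rfl⟩ | ⟨rfl, rfl, rfl⟩ |
        ⟨rfl, rfl, rfl⟩ | ⟨rfl, rfl, rfl⟩
      · rfl
      · rw [starTerm_swap_right]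
      · rw [starTerm_swap_left]
      · rw [starTerm_swap_right, starTerm_swap_left]
      · rw [starTerm_swap_left, starTerm_swap_right]
      · rw [starTerm_swap_left, starTerm_swap_right, starTerm_swap_left]
    · rw [starTerm, AlternatingMap.smul_apply]
      have h2 : contract (b k) (contract (b j) (contract (b i) vol)) ![b 3, b 4, b 5, b 6] =
          vol (b ∘ ![i, j, k, 3, 4, 5, 6]) := by
        rw [contract_apply, contract_apply, contract_apply]
        congr 1
        ext m
        fin_cases m <;> rfl
      rw [h2, vol.map_eq_zero_of_not_injective _ (fun h3 => h h3.of_comp), smul_zero]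
  have hcount : (∑ i : Fin 7, ∑ j : Fin 7, ∑ k : Fin 7,
      if Function.Injective ![i, j, k, 3, 4, 5, 6] then 1 else 0) = 6 := by decide +kernel
  have hvol : contract (b 2) (contract (b 1) (contract (b 0) vol)) ![b 3, b 4, b 5, b 6] = vol b := by
    rw [contract_apply, contract_apply, contract_apply]
    congr 1
    ext m
    fin_cases m <;> rfl
  have hsum : starExpr vol b φ ![b 3, b 4, b 5, b 6] =
      ∑ i, ∑ j, ∑ k, starTerm vol φ (b i) (b j) (b k) ![b 3, b 4, b 5, b 6] := by
    simp only [starExpr, KForm.sum_apply]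
    rfl
  rw [hsum, Finset.sum_congr rfl fun i _ => Finset.sum_congr rfl fun j _ =>
    Finset.sum_congr rfl fun k _ => hT i j k]
  rw [sum_ite_eq_cast_mul (fun i j k => Function.Injective ![i, j, k, 3, 4, 5, 6]), hcount,
    starTerm, AlternatingMap.smul_apply, hvol]
  generalize vol b = c
  generalize φ ![b 0, b 1, b 2] = d
  rw [smul_eq_mul, Nat.cast_ofNat]
  ring

end Metric

/-! ### Closedness of the Hodge dual as symmetry of the matrix of structure sums. -/

section Coclosed
variable {V : Type*} [AddCommGroup V] [Module ℝ V]

theorem IsHodgeDual.apply_perm {g : LinearMap.BilinForm ℝ V} {vol : KForm V 7} {φ : KForm V 3}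
    {ψ : KForm V 4} (h : IsHodgeDual g vol φ ψ) {b : Module.Basis (Fin 7) ℝ V}
    (hb : IsOrthonormalBasis g b) (σ : Perm (Fin 7)) :
    ψ ![b (σ 3), b (σ 4), b (σ 5), b (σ 6)] =
      ((sign σ : ℤ) : ℝ) * vol b * φ ![b (σ 0), b (σ 1), b (σ 2)] := by
  have h1 := starExpr_apply_basis vol φ (b.reindex σ.symm)
  rw [← h _ (hb.reindex σ.symm)] at h1
  simp only [Module.Basis.reindex_apply, Equiv.symm_symm] at h1
  rw [h1]
  congr 1
  rw [← KForm.map_perm_basis]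
  congr 1
  ext i
  simp

variable {L : Type*} [LieRing L] [LieAlgebra ℝ L]

/-- The sum `∑ᵢⱼ cᵃᵢⱼ φ (b_c, bᵢ, bⱼ)`, where `cᵃᵢⱼ` are the structure constants in the basis `b`. -/
noncomputable def structureSum (φ : KForm L 3) (b : Module.Basis (Fin 7) ℝ L) (a c : Fin 7) : ℝ :=
  ∑ i, ∑ j, b.repr ⁅b i, b j⁆ a * φ ![b c, b i, b j]

theorem repr_lie_skew (b : Module.Basis (Fin 7) ℝ L) (x y : L) (a : Fin 7) :
    b.repr ⁅x, y⁆ a = - b.repr ⁅y, x⁆ a := by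
  rw [← lie_skew, map_neg]
  rfl

/-- Expand `[b₂, b₃]` in the basis: the components along `b₄, b₅, b₆` give repeated arguments, those
along `b₂, b₃` vanish by `hc`, and only `b₀, b₁` survive. -/
theorem hodgeDual_apply_lie {g : LinearMap.BilinForm ℝ L} {vol : KForm L 7} {φ : KForm L 3}
    {ψ : KForm L 4} (h : IsHodgeDual g vol φ ψ) {b : Module.Basis (Fin 7) ℝ L}
    (hb : IsOrthonormalBasis g b) (hc : ∀ i j, b.repr ⁅b i, b j⁆ i = 0) :
    ψ ![⁅b 2, b 3⁆, b 4, b 5, b 6] = vol b * (b.repr ⁅b 2, b 3⁆ 1 * φ ![b 0, b 2, b 3] -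
      b.repr ⁅b 2, b 3⁆ 0 * φ ![b 1, b 2, b 3]) := by
  have h1 : ψ ![⁅b 2, b 3⁆, b 4, b 5, b 6] =
      ∑ a, b.repr ⁅b 2, b 3⁆ a * ψ ![b a, b 4, b 5, b 6] := by
    have h2 := congrArg (fun α : KForm L 3 => α ![b 4, b 5, b 6])
      (map_sum (ψ.curryLeft) (fun a => b.repr ⁅b 2, b 3⁆ a • b a) Finset.univ)
    rw [b.sum_repr] at h2
    refine h2.trans ?_
    rw [KForm.sum_apply]
    simp
  have h3 : b.repr ⁅b 2, b 3⁆ 3 = 0 := by rw [repr_lie_skew, hc, neg_zero]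
  have hz : ∀ a : Fin 7, (a = 4 ∨ a = 5 ∨ a = 6) → ψ ![b a, b 4, b 5, b 6] = 0 := by
    rintro a (rfl | rfl | rfl)
    · exact ψ.map_eq_zero_of_eq _ (i := 0) (j := 1) rfl (by decide)
    · exact ψ.map_eq_zero_of_eq _ (i := 0) (j := 2) rfl (by decide)
    · exact ψ.map_eq_zero_of_eq _ (i := 0) (j := 3) rfl (by decide)
  have h0 : ψ ![b 0, b 4, b 5, b 6] = -1 * vol b * φ ![b 1, b 2, b 3] := by
    have h4 := h.apply_perm hb (swap 0 1 * swap 1 2 * swap 2 3)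
    rw [show sign (swap 0 1 * swap 1 2 * swap 2 3 : Perm (Fin 7)) = -1 by decide +kernel] at h4
    refine Eq.trans h4 ?_
    simp only [Units.val_neg, Units.val_one, Int.cast_neg, Int.cast_one]
    rfl
  have h1' : ψ ![b 1, b 4, b 5, b 6] = vol b * φ ![b 0, b 2, b 3] := by
    have h4 := h.apply_perm hb (swap 1 2 * swap 2 3)
    rw [show sign (swap 1 2 * swap 2 3 : Perm (Fin 7)) = 1 by decide +kernel] at h4
    refine Eq.trans h4 ?_
    simp only [Units.val_one, Int.cast_one, one_mul]
    rfl
  rw [h1, Fin.sum_univ_seven, h0, h1', hc 2 3, h3, hz 4 (by simp), hz 5 (by simp), hz 6 (by simp)]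
  ring

/-- Moving positions `i < j` to the front is a shuffle of sign `(-1)^(i + j - 1)`, hence the overall
minus sign. -/
theorem ceDifferential_eq_sum (ψ : KForm L 4) (x : Fin 5 → L) :
    ceDifferential ψ x = -∑ i, ((sign (shuffleTwoThree i) : ℤ) : ℝ) *
      ψ ![⁅x (shuffleTwoThree i 0), x (shuffleTwoThree i 1)⁆, x (shuffleTwoThree i 2),
        x (shuffleTwoThree i 3), x (shuffleTwoThree i 4)] := by
  have hs : ∀ i, sign (shuffleTwoThree i) =
      (![1, -1, 1, -1, 1, -1, 1, 1, -1, 1] : Fin 10 → ℤˣ) i := by decide +kernel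
  have hv : ∀ i k, shuffleTwoThree i k = (![![0, 1, 2, 3, 4], ![0, 2, 1, 3, 4], ![0, 3, 1, 2, 4],
      ![0, 4, 1, 2, 3], ![1, 2, 0, 3, 4], ![1, 3, 0, 2, 4], ![1, 4, 0, 2, 3], ![2, 3, 0, 1, 4],
      ![2, 4, 0, 1, 3], ![3, 4, 0, 1, 2]] : Fin 10 → Fin 5 → Fin 5) i k := by decide +kernel
  have hF : ∀ (a : L) (i : Fin 4) (j : Fin 5),
      (Fin.cons a fun m : Fin 3 => x (j.succAbove (i.succAbove m)) : Fin 4 → L) =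
      ![a, x (j.succAbove (i.succAbove 0)), x (j.succAbove (i.succAbove 1)),
        x (j.succAbove (i.succAbove 2))] := by
    intro a i j
    ext m
    fin_cases m <;> rfl
  have hT : ∀ (i : Fin 4) (j : Fin 5) (m : Fin 3), j.succAbove (i.succAbove m) =
      (![![![2, 3, 4], ![2, 3, 4], ![1, 3, 4], ![1, 2, 4], ![1, 2, 3]],
        ![![1, 3, 4], ![0, 3, 4], ![0, 3, 4], ![0, 2, 4], ![0, 2, 3]],
        ![![1, 2, 4], ![0, 2, 4], ![0, 1, 4], ![0, 1, 4], ![0, 1, 3]],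
        ![![1, 2, 3], ![0, 2, 3], ![0, 1, 3], ![0, 1, 2], ![0, 1, 2]]] :
          Fin 4 → Fin 5 → Fin 3 → Fin 5) i j m := by decide +kernel
  simp only [ceDifferential, hF]
  simp only [Fin.sum_univ_succ, Fin.sum_univ_zero, hs, hv, hT]
  simp
  ring

/-- The component `cᵃ` of the Lie bracket in a basis, as a `2`-form. -/
noncomputable def bracketForm (b : Module.Basis (Fin 7) ℝ L) (a : Fin 7) : KForm L 2 where
  toFun v := b.repr ⁅v 0, v 1⁆ a
  map_update_add' := by
    intro _ m i x y
    fin_cases i <;> simp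
  map_update_smul' := by
    intro _ m i c x
    fin_cases i <;> simp
  map_eq_zero_of_eq' := by
    intro v i j h hij
    fin_cases i <;> fin_cases j <;> first | exact absurd rfl hij | simp_all

/-- The `5`-form `cᵃ ∧ (b_a ⌟ ψ)`. -/
noncomputable def bracketWedge (b : Module.Basis (Fin 7) ℝ L) (ψ : KForm L 4) (a : Fin 7) :
    KForm L 5 :=
  wedge (bracketForm b a) (contract (b a) ψ)

theorem bracketWedge_apply (b : Module.Basis (Fin 7) ℝ L) (ψ : KForm L 4) (a : Fin 7)
    (x : Fin 5 → L) : bracketWedge b ψ a x = ∑ i, ((sign (shuffleTwoThree i) : ℤ) : ℝ) *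
      (b.repr ⁅x (shuffleTwoThree i 0), x (shuffleTwoThree i 1)⁆ a *
        ψ ![b a, x (shuffleTwoThree i 2), x (shuffleTwoThree i 3), x (shuffleTwoThree i 4)]) :=
  wedge_apply_two_three _ _ x

/-- The Chevalley–Eilenberg differential of a `4`-form, as a `5`-form. -/
noncomputable def ceForm (b : Module.Basis (Fin 7) ℝ L) (ψ : KForm L 4) : KForm L 5 :=
  -∑ a, bracketWedge b ψ a

theorem apply_vecCons_sum {k : ℕ} {ι : Type*} (s : Finset ι) (α : KForm V (k + 1)) (v : ι → V)
    (x : Fin k → V) :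
    α (Matrix.vecCons (∑ i ∈ s, v i) x) = ∑ i ∈ s, α (Matrix.vecCons (v i) x) := by
  have h := congrArg (fun β : KForm V k => β x) (map_sum α.curryLeft v s)
  exact h.trans (KForm.sum_apply _ _ _)

theorem apply_vecCons_smul {k : ℕ} (α : KForm V (k + 1)) (c : ℝ) (v : V) (x : Fin k → V) :
    α (Matrix.vecCons (c • v) x) = c * α (Matrix.vecCons v x) :=
  congrArg (fun β : KForm V k => β x) (map_smul α.curryLeft c v)

theorem apply_vecCons_eq_sum_repr {k : ℕ} (b : Module.Basis (Fin 7) ℝ V) (α : KForm V (k + 1))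
    (v : V) (x : Fin k → V) :
    α (Matrix.vecCons v x) = ∑ a, b.repr v a * α (Matrix.vecCons (b a) x) := by
  conv_lhs => rw [← b.sum_repr v]
  simp only [apply_vecCons_sum, apply_vecCons_smul]

/-- Since `ceDifferential` is a bare function, this identification is what shows that it is
alternating, so that its vanishing can be tested on distinct basis vectors. -/
theorem ceForm_apply (b : Module.Basis (Fin 7) ℝ L) (ψ : KForm L 4) (x : Fin 5 → L) :
    ceForm b ψ x = ceDifferential ψ x := by
  rw [ceDifferential_eq_sum, ceForm, AlternatingMap.neg_apply, KForm.sum_apply]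
  refine congrArg Neg.neg ?_
  simp only [bracketWedge_apply]
  rw [Finset.sum_comm]
  refine Finset.sum_congr rfl fun i _ => ?_
  rw [apply_vecCons_eq_sum_repr b, Finset.mul_sum]

/-- The extension of a permutation of `Fin 5` to the last five elements of `Fin 7`. -/
def extendPerm (σ : Perm (Fin 5)) : Perm (Fin 7) :=
  ((finSumFinEquiv (m := 2) (n := 5)).symm.trans (Perm.sumCongr 1 σ)).trans finSumFinEquiv

theorem sign_extendPerm (σ : Perm (Fin 5)) : sign (extendPerm σ) = sign σ := by
  have h := sign_symm_trans_trans (Perm.sumCongr (1 : Perm (Fin 2)) σ)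
    (finSumFinEquiv (m := 2) (n := 5))
  rw [sign_sumCongr, Perm.sign_one, one_mul] at h
  exact h

/-- Each of the ten shuffles is `hodgeDual_apply_lie` for a permuted basis; the sign of the shuffle
cancels against the sign of `vol` there. Structure sums run over ordered pairs, whence the factor `1
/ 2`. -/
theorem ceDifferential_apply_basis {g : LinearMap.BilinForm ℝ L} {vol : KForm L 7} {φ : KForm L 3}
    {ψ : KForm L 4} (h : IsHodgeDual g vol φ ψ) {b : Module.Basis (Fin 7) ℝ L}
    (hb : IsOrthonormalBasis g b) (hc : ∀ i j, b.repr ⁅b i, b j⁆ i = 0) :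
    ceDifferential ψ ![b 2, b 3, b 4, b 5, b 6] =
      vol b / 2 * (structureSum φ b 0 1 - structureSum φ b 1 0) := by
  have hT : ∀ σ : Perm (Fin 5), ((sign σ : ℤ) : ℝ) *
      ψ ![⁅b (extendPerm σ 2), b (extendPerm σ 3)⁆, b (extendPerm σ 4), b (extendPerm σ 5),
        b (extendPerm σ 6)] = vol b *
      (b.repr ⁅b (extendPerm σ 2), b (extendPerm σ 3)⁆ 1 *
          φ ![b 0, b (extendPerm σ 2), b (extendPerm σ 3)] -
        b.repr ⁅b (extendPerm σ 2), b (extendPerm σ 3)⁆ 0 *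
          φ ![b 1, b (extendPerm σ 2), b (extendPerm σ 3)]) := by
    intro σ
    have h0 : extendPerm σ 0 = 0 := rfl
    have h1 : extendPerm σ 1 = 1 := rfl
    have h2 := hodgeDual_apply_lie h (hb.reindex (extendPerm σ).symm) (by
      intro i j
      simp [hc])
    have hvol : vol (b.reindex (extendPerm σ).symm) = ((sign σ : ℤ) : ℝ) * vol b := by
      rw [← sign_extendPerm, ← KForm.map_perm_basis]
      congr 1
      ext i
      simp
    rw [hvol] at h2
    simp only [Module.Basis.reindex_apply, Equiv.symm_symm, Module.Basis.repr_reindex_apply,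
      h0, h1] at h2
    rw [h2, mul_assoc, ← mul_assoc]
    have : ((sign σ : ℤ) : ℝ) * ((sign σ : ℤ) : ℝ) = 1 := by
      rcases Int.units_eq_one_or (sign σ) with h | h <;> simp [h]
    rw [this, one_mul]
  have hx : ∀ (σ : Perm (Fin 5)) (k : Fin 5), (![b 2, b 3, b 4, b 5, b 6] : Fin 5 → L) (σ k) =
      b (extendPerm σ ((![2, 3, 4, 5, 6] : Fin 5 → Fin 7) k)) := by
    intro σ k
    have : extendPerm σ ((![2, 3, 4, 5, 6] : Fin 5 → Fin 7) k) =
        (![2, 3, 4, 5, 6] : Fin 5 → Fin 7) (σ k) := by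
      have h1 : ∀ m : Fin 5, (![2, 3, 4, 5, 6] : Fin 5 → Fin 7) m = Fin.natAdd 2 m := by decide
      rw [h1, h1]
      fin_cases k <;> rfl
    rw [this]
    generalize σ k = m
    fin_cases m <;> rfl
  -- The ten shuffles list the unordered pairs in `{2, …, 6}`. Pairs involving `0` or `1` drop out
  -- of both structure sums, by `hc` or by a repeated argument of `φ`.
  have hpair : ∀ (A : Fin 7 → Fin 7 → ℝ), (∀ p q, A p q = A q p) → (∀ p, A p p = 0) →
      (∀ q, A 0 q = 0) → (∀ q, A 1 q = 0) → ∑ p, ∑ q, A p q =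
        2 * ∑ i, A (extendPerm (shuffleTwoThree i) 2) (extendPerm (shuffleTwoThree i) 3) := by
    intro A hs hd h0 h1
    have ht : ∀ i, (extendPerm (shuffleTwoThree i) 2, extendPerm (shuffleTwoThree i) 3) =
      (![(2, 3), (2, 4), (2, 5), (2, 6), (3, 4), (3, 5), (3, 6), (4, 5), (4, 6), (5, 6)] :
        Fin 10 → Fin 7 × Fin 7) i := by decide +kernel
    have ht2 : ∀ i, extendPerm (shuffleTwoThree i) 2 = _ := fun i => congrArg Prod.fst (ht i)
    have ht3 : ∀ i, extendPerm (shuffleTwoThree i) 3 = _ := fun i => congrArg Prod.snd (ht i)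
    have h0' : ∀ q, A q 0 = 0 := fun q => by rw [hs, h0]
    have h1' : ∀ q, A q 1 = 0 := fun q => by rw [hs, h1]
    simp only [ht2, ht3, Fin.sum_univ_seven, h0, h1, h0', h1', hd]
    simp only [Fin.sum_univ_succ]
    simp
    rw [hs 3 2, hs 4 2, hs 5 2, hs 6 2, hs 4 3, hs 5 3, hs 6 3, hs 5 4, hs 6 4, hs 6 5]
    ring
  have hφ : ∀ x y z, φ ![x, y, z] = -φ ![x, z, y] := fun x y z =>
    congrArg (fun α => α ![]) (contract_swap z y (contract x φ))
  have hφ0 : ∀ x y, φ ![x, x, y] = 0 := fun x y =>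
    φ.map_eq_zero_of_eq _ (i := 0) (j := 1) rfl (by decide)
  have hφ1 : ∀ x y, φ ![y, x, x] = 0 := fun x y =>
    φ.map_eq_zero_of_eq _ (i := 1) (j := 2) rfl (by decide)
  have hA : ∀ c d : Fin 7, (c = 0 ∧ d = 1 ∨ c = 1 ∧ d = 0) → structureSum φ b c d =
      2 * ∑ i, b.repr ⁅b (extendPerm (shuffleTwoThree i) 2), b (extendPerm (shuffleTwoThree i) 3)⁆ c *
        φ ![b d, b (extendPerm (shuffleTwoThree i) 2), b (extendPerm (shuffleTwoThree i) 3)] := by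
    intro c d hcd
    refine hpair (fun p q => b.repr ⁅b p, b q⁆ c * φ ![b d, b p, b q]) ?_ ?_ ?_ ?_
    · intro p q
      rw [repr_lie_skew, hφ]
      ring
    · intro p
      simp [hφ1]
    · intro q
      rcases hcd with ⟨rfl, rfl⟩ | ⟨rfl, rfl⟩ <;> simp [hc, hφ0]
    · intro q
      rcases hcd with ⟨rfl, rfl⟩ | ⟨rfl, rfl⟩ <;> simp [hc, hφ0]
  rw [ceDifferential_eq_sum, hA 0 1 (by simp), hA 1 0 (by simp)]
  simp only [hx]
  simp only [Matrix.cons_val]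
  rw [Finset.sum_congr rfl fun i _ => hT (shuffleTwoThree i), ← Finset.mul_sum,
    Finset.sum_sub_distrib]
  ring

theorem structureSum_reindex (φ : KForm L 3) (b : Module.Basis (Fin 7) ℝ L) (σ : Perm (Fin 7))
    (a c : Fin 7) :
    structureSum φ (b.reindex σ.symm) a c = structureSum φ b (σ a) (σ c) := by
  simp only [structureSum, Module.Basis.reindex_apply, Module.Basis.repr_reindex_apply,
    Equiv.symm_symm]
  rw [← Equiv.sum_comp σ fun i => ∑ j, b.repr ⁅b i, b j⁆ (σ a) * φ ![b (σ c), b i, b j]]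
  refine Finset.sum_congr rfl fun i _ => ?_
  rw [← Equiv.sum_comp σ fun j => b.repr ⁅b (σ i), b j⁆ (σ a) * φ ![b (σ c), b (σ i), b j]]

theorem ceDifferential_apply_perm {g : LinearMap.BilinForm ℝ L} {vol : KForm L 7} {φ : KForm L 3}
    {ψ : KForm L 4} (h : IsHodgeDual g vol φ ψ) {b : Module.Basis (Fin 7) ℝ L}
    (hb : IsOrthonormalBasis g b) (hc : ∀ i j, b.repr ⁅b i, b j⁆ i = 0) (σ : Perm (Fin 7)) :
    ceDifferential ψ ![b (σ 2), b (σ 3), b (σ 4), b (σ 5), b (σ 6)] =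
      ((sign σ : ℤ) : ℝ) * vol b / 2 *
        (structureSum φ b (σ 0) (σ 1) - structureSum φ b (σ 1) (σ 0)) := by
  have h1 := ceDifferential_apply_basis h (hb.reindex σ.symm) (by
    intro i j
    simp [hc])
  rw [structureSum_reindex, structureSum_reindex] at h1
  have hvol : vol (b.reindex σ.symm) = ((sign σ : ℤ) : ℝ) * vol b := by
    rw [← KForm.map_perm_basis]
    congr 1
    ext i
    simp
  rw [hvol] at h1
  simpa using h1

/-- The Hodge dual of `φ` is closed if and only if the matrix of structure sums is symmetric. -/
theorem ceDifferential_eq_zero_iff {g : LinearMap.BilinForm ℝ L} {vol : KForm L 7} {φ : KForm L 3}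
    {ψ : KForm L 4} (h : IsHodgeDual g vol φ ψ) {b : Module.Basis (Fin 7) ℝ L}
    (hb : IsOrthonormalBasis g b) (hvol : vol b ≠ 0) (hc : ∀ i j, b.repr ⁅b i, b j⁆ i = 0) :
    (∀ x, ceDifferential ψ x = 0) ↔ ∀ a c, structureSum φ b a c = structureSum φ b c a := by
  constructor
  · intro h0 a c
    by_cases hac : a = c
    · rw [hac]
    obtain ⟨σ, ha, hc'⟩ : ∃ σ : Perm (Fin 7), σ 0 = a ∧ σ 1 = c := by
      have hP := Equiv.Perm.isMultiplyPretransitive (Fin 7) 2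
      rw [MulAction.isMultiplyPretransitive_iff] at hP
      obtain ⟨σ, hσ⟩ := hP ⟨![0, 1], by decide⟩ ⟨![a, c], by
        intro i j hij
        fin_cases i <;> fin_cases j <;> simp_all [eq_comm]⟩
      exact ⟨σ, congrArg (fun f : Fin 2 ↪ Fin 7 => f 0) hσ,
        congrArg (fun f : Fin 2 ↪ Fin 7 => f 1) hσ⟩
    have h1 := ceDifferential_apply_perm h hb hc σ
    rw [h0, ha, hc'] at h1
    have hs : ((sign σ : ℤ) : ℝ) ≠ 0 := by
      exact_mod_cast (sign σ).ne_zero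
    have h2 : ((sign σ : ℤ) : ℝ) * vol b / 2 ≠ 0 := by positivity
    have := (mul_eq_zero.mp h1.symm).resolve_left h2
    linarith
  · intro hS x
    rw [← ceForm_apply b]
    suffices ceForm b ψ = 0 by rw [this]; rfl
    refine Module.Basis.ext_alternating b fun v hv => ?_
    -- Five distinct basis vectors omit exactly two indices, `σ 0` and `σ 1`, and these index the
    -- relevant entry of the matrix.
    obtain ⟨σ, hσ⟩ : ∃ σ : Perm (Fin 7), ∀ k, σ (Fin.natAdd 2 k) = v k := by
      have hP := Equiv.Perm.isMultiplyPretransitive (Fin 7) 5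
      rw [MulAction.isMultiplyPretransitive_iff] at hP
      obtain ⟨σ, hσ⟩ := hP ⟨Fin.natAdd 2, Fin.natAdd_injective 5 2⟩ ⟨v, hv⟩
      exact ⟨σ, fun k => congrArg (fun f : Fin 5 ↪ Fin 7 => f k) hσ⟩
    have h1 := ceDifferential_apply_perm h hb hc σ
    rw [hS, sub_self, mul_zero] at h1
    rw [ceForm_apply]
    refine Eq.trans ?_ h1
    congr 1
    ext k
    rw [← hσ]
    fin_cases k <;> rfl

end Coclosed

/-! ### Normal forms of matrices, by maximisation over the orthogonal group. -/

section MatrixLemmas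
open Matrix

theorem exists_mulVec_eq_zero_of_skew {n : ℕ} (hn : Odd n) (A : Matrix (Fin n) (Fin n) ℝ)
    (hA : Aᵀ = -A) : ∃ x ≠ 0, A *ᵥ x = 0 := by
  rw [Matrix.exists_mulVec_eq_zero_iff]
  have h := congrArg Matrix.det hA
  rw [det_transpose, det_neg, Fintype.card_fin, hn.neg_one_pow] at h
  linarith

theorem exists_orthogonal_maximizer {n : ℕ} (f : Matrix (Fin n) (Fin n) ℝ → ℝ)
    (hf : Continuous f) : ∃ R : Matrix (Fin n) (Fin n) ℝ, R * Rᵀ = 1 ∧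
      ∀ S : Matrix (Fin n) (Fin n) ℝ, S * Sᵀ = 1 → f S ≤ f R := by
  have hcpt : IsCompact {R : Matrix (Fin n) (Fin n) ℝ | R * Rᵀ = 1} := by
    have hbox : IsCompact (Set.univ.pi fun _ : Fin n => Set.univ.pi fun _ : Fin n =>
        Set.Icc (-1 : ℝ) 1) :=
      isCompact_univ_pi fun _ => isCompact_univ_pi fun _ => isCompact_Icc
    refine hbox.of_isClosed_subset ?_ ?_
    · exact isClosed_eq (by fun_prop) continuous_const
    · intro (R : Matrix (Fin n) (Fin n) ℝ) hR i _ j _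
      have h1 : ∑ k, R i k * R i k = 1 := by
        have hR' : R * Rᵀ = 1 := hR
        have h : (R * Rᵀ) i i = 1 := by rw [hR', Matrix.one_apply_eq]
        rwa [Matrix.mul_apply] at h
      have h2 : R i j * R i j ≤ 1 := by
        rw [← h1]
        exact Finset.single_le_sum (f := fun k => R i k * R i k)
          (fun k _ => mul_self_nonneg _) (Finset.mem_univ j)
      exact abs_le.mp (abs_le_one_iff_mul_self_le_one.mpr h2)
  obtain ⟨R, hR, hmax⟩ := hcpt.exists_isMaxOn ⟨1, by simp⟩ hf.continuousOn
  exact ⟨R, hR, fun S hS => hmax hS⟩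

attribute [local instance] Matrix.linftyOpNormedRing Matrix.linftyOpNormedAlgebra

theorem exp_mul_transpose_of_skew {n : ℕ} {X : Matrix (Fin n) (Fin n) ℝ} (hX : Xᵀ = -X) (t : ℝ) :
    (NormedSpace.exp (t • X))ᵀ = NormedSpace.exp (t • -X) ∧
      NormedSpace.exp (t • X) * (NormedSpace.exp (t • X))ᵀ = 1 := by
  have h : (NormedSpace.exp (t • X))ᵀ = NormedSpace.exp (t • -X) := by
    rw [← Matrix.exp_transpose, transpose_smul, hX]
  refine ⟨h, ?_⟩
  rw [h, ← Matrix.exp_add_of_commute]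
  · simp
  · simp

theorem orthogonal_mul {n : ℕ} {R S : Matrix (Fin n) (Fin n) ℝ} (hR : R * Rᵀ = 1)
    (hS : S * Sᵀ = 1) : (S * R) * (S * R)ᵀ = 1 := by
  rw [transpose_mul, Matrix.mul_assoc, ← Matrix.mul_assoc R, hR, Matrix.one_mul, hS]

theorem eq_zero_of_skew_of_trace {n : ℕ} {X : Matrix (Fin n) (Fin n) ℝ} (hX : Xᵀ = -X)
    (h : trace (X * X) = 0) : X = 0 := by
  rw [← Matrix.trace_conjTranspose_mul_self_eq_zero_iff, conjTranspose_eq_transpose_of_trivial, hX,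
    Matrix.neg_mul, trace_neg, h, neg_zero]

/-- A square matrix becomes symmetric after multiplication with a suitable orthogonal matrix. -/
theorem exists_orthogonal_mul_symm {n : ℕ} (A : Matrix (Fin n) (Fin n) ℝ) :
    ∃ R : Matrix (Fin n) (Fin n) ℝ, R * Rᵀ = 1 ∧ (R * A)ᵀ = R * A := by
  obtain ⟨R, hR, hmax⟩ := exists_orthogonal_maximizer (fun R => trace (R * A)) (by fun_prop)
  refine ⟨R, hR, ?_⟩
  set M := R * A with hM
  -- Vary the maximiser along `exp (tX) R` with the skew `X = Mᵀ - M`. The first variation `tr (X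
  -- M)` vanishes, hence so does `tr (X²)`, which is minus the squared Frobenius norm of `X`.
  have hX : (Mᵀ - M)ᵀ = -(Mᵀ - M) := by simp
  have hd : HasDerivAt (fun t : ℝ => trace (NormedSpace.exp (t • (Mᵀ - M)) * M))
      (trace ((Mᵀ - M) * M)) 0 := by
    have h1 := (hasDerivAt_exp_smul_const (𝕂 := ℝ) (Mᵀ - M) (0 : ℝ)).mul_const M
    simp only [zero_smul, NormedSpace.exp_zero, one_mul] at h1
    exact (Matrix.traceLinearMap (Fin n) ℝ ℝ).toContinuousLinearMap.hasFDerivAt.comp_hasDerivAt _ h1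
  have hmax' : IsLocalMax (fun t : ℝ => trace (NormedSpace.exp (t • (Mᵀ - M)) * M)) 0 := by
    refine Filter.Eventually.of_forall fun t => ?_
    have := hmax _ (orthogonal_mul hR (exp_mul_transpose_of_skew hX t).2)
    simpa [hM, Matrix.mul_assoc] using this
  have h0 := hmax'.hasDerivAt_eq_zero hd
  have h1 : trace ((Mᵀ - M) * Mᵀ) = -trace ((Mᵀ - M) * M) := by
    rw [← trace_transpose, transpose_mul, transpose_transpose, hX, Matrix.mul_neg, trace_neg,
      trace_mul_comm]
  have h2 := eq_zero_of_skew_of_trace hX (by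
    rw [Matrix.mul_sub, trace_sub, h1, h0]
    simp)
  exact sub_eq_zero.mp h2

/-- A skew-symmetric matrix commutes with any given skew-symmetric matrix after conjugation with a
suitable orthogonal matrix. -/
theorem exists_orthogonal_conj_commute {n : ℕ} (A J : Matrix (Fin n) (Fin n) ℝ) (hA : Aᵀ = -A)
    (hJ : Jᵀ = -J) : ∃ R : Matrix (Fin n) (Fin n) ℝ, R * Rᵀ = 1 ∧
      (R * A * Rᵀ) * J = J * (R * A * Rᵀ) := by
  obtain ⟨R, hR, hmax⟩ := exists_orthogonal_maximizer (fun R => trace (R * A * Rᵀ * J)) (by fun_prop)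
  refine ⟨R, hR, ?_⟩
  set B := R * A * Rᵀ with hB
  have hBt : Bᵀ = -B := by
    rw [hB, transpose_mul, transpose_mul, transpose_transpose, hA]
    simp [Matrix.mul_assoc]
  -- The commutator is itself skew, and the first variation of `tr (B J)` in its direction is `tr (X
  -- (BJ - JB)) = tr (X²)`.
  obtain ⟨X, hXdef⟩ : ∃ X, X = B * J - J * B := ⟨_, rfl⟩
  have hX : Xᵀ = -X := by
    rw [hXdef, transpose_sub, transpose_mul B J, transpose_mul J B, hBt, hJ]
    simp
  have hd : HasDerivAt (fun t : ℝ => trace (NormedSpace.exp (t • X) * B *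
      NormedSpace.exp (t • -X) * J)) (trace (X * B * J + B * (-X) * J)) 0 := by
    have h1 := hasDerivAt_exp_smul_const (𝕂 := ℝ) X (0 : ℝ)
    have h2 := hasDerivAt_exp_smul_const (𝕂 := ℝ) (-X) (0 : ℝ)
    have h3 := ((h1.mul_const B).mul h2).mul_const J
    simp only [zero_smul, NormedSpace.exp_zero, one_mul, mul_one, add_mul] at h3
    exact (Matrix.traceLinearMap (Fin n) ℝ ℝ).toContinuousLinearMap.hasFDerivAt.comp_hasDerivAt _ h3
  have hmax' : IsLocalMax (fun t : ℝ => trace (NormedSpace.exp (t • X) * B *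
      NormedSpace.exp (t • -X) * J)) 0 := by
    refine Filter.Eventually.of_forall fun t => ?_
    have := hmax _ (orthogonal_mul hR (exp_mul_transpose_of_skew hX t).2)
    rw [transpose_mul, (exp_mul_transpose_of_skew hX t).1] at this
    simpa [hB, Matrix.mul_assoc] using this
  have h0 := hmax'.hasDerivAt_eq_zero hd
  have h1 : trace (B * (-X) * J) = - trace (X * (J * B)) := by
    rw [Matrix.mul_neg, Matrix.neg_mul, trace_neg, Matrix.mul_assoc, trace_mul_comm, Matrix.mul_assoc]
  have h2 : trace (X * X) = 0 := by
    have h3 : X * X = X * (B * J) - X * (J * B) := by rw [← Matrix.mul_sub, ← hXdef]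
    rw [h3, trace_sub, ← h0, trace_add, h1, Matrix.mul_assoc X B J]
    ring
  rw [← sub_eq_zero, ← hXdef, eq_zero_of_skew_of_trace hX h2]

end MatrixLemmas

/-! ### Adapted orthonormal bases and the kernel of `v ⌟ φ`. -/

section OrthonormalBases
variable {V : Type*} [AddCommGroup V] [Module ℝ V]

theorem exists_linearIndependent_extension [FiniteDimensional ℝ V] {k n : ℕ} (hkn : k ≤ n)
    (hn : n ≤ Module.finrank ℝ V) {v : Fin k → V} (hv : LinearIndependent ℝ v) :
    ∃ w : Fin n → V, LinearIndependent ℝ w ∧ ∀ i : Fin k, w (i.castLE hkn) = v i := by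
  induction n, hkn using Nat.le_induction with
  | base => exact ⟨v, hv, fun i => rfl⟩
  | succ n hkn ih =>
    obtain ⟨w, hw, hwv⟩ := ih (by omega)
    obtain ⟨x, hx⟩ := exists_linearIndependent_snoc_of_lt_finrank hw (by omega)
    refine ⟨Fin.snoc w x, hx, fun i => ?_⟩
    rw [← hwv i]
    exact Fin.snoc_castSucc (α := fun _ => V) x w (i.castLE hkn)

/-- A `g`-orthonormal basis obtained by the Gram–Schmidt process. -/
theorem exists_orthonormalBasis_mem_span {g : LinearMap.BilinForm ℝ V} (hg : IsInnerProduct g)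
    (hV : Module.finrank ℝ V = 7) {v : Fin 7 → V} (hv : LinearIndependent ℝ v) :
    ∃ e : Module.Basis (Fin 7) ℝ V, IsOrthonormalBasis g e ∧
      ∀ i, e i ∈ Submodule.span ℝ (v '' Set.Iic i) := by
  have : FiniteDimensional ℝ V := Module.finite_of_finrank_pos (by omega)
  let core : InnerProductSpace.Core ℝ V :=
    { inner := fun x y => g x y
      conj_inner_symm := fun x y => hg.symm y x
      re_inner_nonneg := fun x => by
        by_cases hx : x = 0
        · simp [hx]
        · exact (hg.pos x hx).le
      add_left := fun x y z => by simp
      smul_left := fun x y r => by simp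
      definite := fun x hx => by
        by_contra h
        exact (hg.pos x h).ne' hx }
  let : NormedAddCommGroup V := core.toNormedAddCommGroup
  let : InnerProductSpace ℝ V := InnerProductSpace.ofCore core.toCore
  have hinner : ∀ x y : V, inner ℝ x y = g x y := fun _ _ => rfl
  let b := InnerProductSpace.gramSchmidtOrthonormalBasis (𝕜 := ℝ) (by simp [hV]) v
  refine ⟨b.toBasis, fun i j => ?_, fun i => ?_⟩
  · rw [← hinner, b.coe_toBasis]
    exact orthonormal_iff_ite.mp b.orthonormal i j
  · have h0 : InnerProductSpace.gramSchmidtNormed ℝ v i ≠ 0 := by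
      have := InnerProductSpace.gramSchmidtNormed_unit_length (𝕜 := ℝ) i hv
      intro h
      rw [h] at this
      simp at this
    rw [b.coe_toBasis, InnerProductSpace.gramSchmidtOrthonormalBasis_apply _ h0]
    exact Submodule.smul_mem _ _ (InnerProductSpace.gramSchmidt_mem_span ℝ v le_rfl)

/-- By dimension, the first `finrank U` basis vectors already span `U`. -/
theorem repr_eq_zero_of_mem [FiniteDimensional ℝ V] (e : Module.Basis (Fin 7) ℝ V)
    {U : Submodule ℝ V} (hU : ∀ i : Fin 7, i.val < Module.finrank ℝ U → e i ∈ U)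
    {u : V} (hu : u ∈ U) {i : Fin 7} (hi : Module.finrank ℝ U ≤ i.val) : e.repr u i = 0 := by
  have hle : Submodule.span ℝ (Set.range fun j : Fin (Module.finrank ℝ U) =>
      e (j.castLE (hi.trans i.isLt.le))) ≤ U := by
    rw [Submodule.span_le]
    rintro _ ⟨j, rfl⟩
    exact hU _ j.isLt
  have hfin := finrank_span_eq_card (e.linearIndependent.comp
    (fun j : Fin (Module.finrank ℝ U) => j.castLE (hi.trans i.isLt.le)) (Fin.castLE_injective _))
  rw [Fintype.card_fin] at hfin
  have hspan := Submodule.eq_of_le_of_finrank_eq hle hfin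
  rw [← hspan] at hu
  induction hu using Submodule.span_induction with
  | mem x hx =>
    obtain ⟨j, rfl⟩ := hx
    have : j.castLE (hi.trans i.isLt.le) ≠ i := by
      intro h
      have := congrArg Fin.val h
      simp at this
      omega
    simp [this]
  | zero => simp
  | add x y _ _ hx hy => simp [hx, hy]
  | smul c x _ hx => simp [hx]

/-- A `g`-orthonormal basis adapted to a flag of two subspaces. -/
theorem exists_orthonormalBasis_flag {g : LinearMap.BilinForm ℝ V} (hg : IsInnerProduct g)
    (hV : Module.finrank ℝ V = 7) {U W : Submodule ℝ V} (hUW : U ≤ W) :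
    ∃ e : Module.Basis (Fin 7) ℝ V, IsOrthonormalBasis g e ∧
      (∀ i : Fin 7, i.val < Module.finrank ℝ U → e i ∈ U) ∧
      (∀ i : Fin 7, i.val < Module.finrank ℝ W → e i ∈ W) := by
  have : FiniteDimensional ℝ V := Module.finite_of_finrank_pos (by omega)
  have hm : Module.finrank ℝ W ≤ 7 := hV ▸ W.finrank_le
  have hk : Module.finrank ℝ U ≤ Module.finrank ℝ W := Submodule.finrank_mono hUW
  let bU := Module.finBasis ℝ U
  -- Extend a basis of `U` to `W` and then to `V`; Gram–Schmidt preserves the spans of initial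
  -- segments.
  have hbU : LinearIndependent ℝ fun i => Submodule.inclusion hUW (bU i) :=
    bU.linearIndependent.map' (Submodule.inclusion hUW) (Submodule.ker_inclusion _ _ hUW)
  obtain ⟨w, hw, hwU⟩ := exists_linearIndependent_extension hk le_rfl hbU
  have hw' : LinearIndependent ℝ fun i => (w i : V) := hw.map' W.subtype W.ker_subtype
  obtain ⟨v, hv, hvw⟩ := exists_linearIndependent_extension hm hV.ge hw'
  obtain ⟨e, he, hspan⟩ := exists_orthonormalBasis_mem_span hg hV hv
  refine ⟨e, he, fun i hi => ?_, fun i hi => ?_⟩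
  · refine Submodule.span_le.mpr ?_ (hspan i)
    rintro _ ⟨j, hj, rfl⟩
    have hj' : j.val < Module.finrank ℝ U := lt_of_le_of_lt hj hi
    have h1 := hvw ⟨j, hj'.trans_le hk⟩
    have h2 := hwU ⟨j, hj'⟩
    have h3 : v j = bU ⟨j, hj'⟩ := by
      refine h1.trans ?_
      exact congrArg Subtype.val h2
    rw [h3]
    exact (bU ⟨j, hj'⟩).2
  · refine Submodule.span_le.mpr ?_ (hspan i)
    rintro _ ⟨j, hj, rfl⟩
    have hj' : j.val < Module.finrank ℝ W := lt_of_le_of_lt hj hi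
    have h1 := hvw ⟨j, hj'⟩
    have h3 : v j = w ⟨j, hj'⟩ := h1
    rw [h3]
    exact (w ⟨j, hj'⟩).2

theorem linearIndependent_of_orthonormal {g : LinearMap.BilinForm ℝ V} {v : Fin 7 → V}
    (hv : ∀ i j, g (v i) (v j) = if i = j then 1 else 0) : LinearIndependent ℝ v := by
  rw [Fintype.linearIndependent_iff]
  intro c hc i
  have h := congrArg (fun x => g x (v i)) hc
  simpa [hv _ i] using h

theorem exists_orthonormalBasis_eq {g : LinearMap.BilinForm ℝ V}
    (hV : Module.finrank ℝ V = 7) {v : Fin 7 → V}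
    (hv : ∀ i j, g (v i) (v j) = if i = j then 1 else 0) :
    ∃ e : Module.Basis (Fin 7) ℝ V, IsOrthonormalBasis g e ∧ ∀ i, e i = v i := by
  let e := basisOfLinearIndependentOfCardEqFinrank (linearIndependent_of_orthonormal hv)
    (by simp [hV])
  have he : ∀ i, e i = v i := fun i => by simp [e]
  exact ⟨e, fun i j => by rw [he, he, hv], he⟩

theorem KForm.wedge_eq_zero {p q : ℕ} (α : KForm V p) (β : KForm V q) (x : Fin (p + q) → V)
    (h : ∀ σ : Perm (Fin p ⊕ Fin q), α (fun k => x (finSumFinEquiv (σ (Sum.inl k)))) = 0 ∨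
      β (fun k => x (finSumFinEquiv (σ (Sum.inr k)))) = 0) : wedge α β x = 0 := by
  rw [wedge_apply_eq_sum (fun σ : ModSumCongr (Fin p) (Fin q) => Quotient.out σ)
    (by simp)]
  refine Finset.sum_eq_zero fun σ _ => ?_
  rcases h (Quotient.out σ) with h | h <;> simp [h]

theorem KForm.wedge_eq_zero_four_three (α : KForm V 4) (β : KForm V 3) (x : Fin 7 → V)
    (h : ∀ σ : Perm (Fin 4 ⊕ Fin 3), α (fun k => x (finSumFinEquiv (σ (Sum.inl k)))) = 0 ∨
      β (fun k => x (finSumFinEquiv (σ (Sum.inr k)))) = 0) : wedge α β x = 0 :=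
  KForm.wedge_eq_zero α β x h

theorem wedge_self_eq_zero_of_mem_ker {α : KForm V 2} {v : V} (hv : ∀ u, α ![v, u] = 0)
    (x : Fin 4 → V) {k : Fin 4} (hk : x k = v) : wedge α α x = 0 := by
  have hα : ∀ f : Fin 2 → V, (∃ l, f l = v) → α f = 0 := by
    rintro f ⟨l, hl⟩
    have hf : f = ![f 0, f 1] := by ext i; fin_cases i <;> rfl
    fin_cases l
    · rw [hf, show f 0 = v from hl, hv]
    · have h := α.map_swap ![v, f 0] (zero_ne_one (α := Fin 2))
      rw [hv, neg_zero] at h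
      rw [← h]
      congr 1
      ext i
      fin_cases i <;> simp [← hl]
  refine KForm.wedge_eq_zero α α x fun σ => ?_
  obtain ⟨s, hs⟩ : ∃ s, finSumFinEquiv (σ s) = k := ⟨σ.symm (finSumFinEquiv.symm k), by simp⟩
  rcases s with l | l
  · exact Or.inl (hα _ ⟨l, by rw [hs, hk]⟩)
  · exact Or.inr (hα _ ⟨l, by rw [hs, hk]⟩)

/-- For a `G₂`-structure, the kernel of `v ⌟ φ` is spanned by `v`. -/
theorem IsG2Structure.not_linearIndependent {φ : KForm V 3} (hφ : IsG2Structure φ)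
    (hV : Module.finrank ℝ V = 7) {v w : V} (hvw : LinearIndependent ℝ ![v, w])
    (h : ∀ u, φ ![v, w, u] = 0) : False := by
  have : FiniteDimensional ℝ V := Module.finite_of_finrank_pos (by omega)
  obtain ⟨b, hb, hbv⟩ := exists_linearIndependent_extension (by norm_num : 2 ≤ 7) hV.ge hvw
  let e := basisOfLinearIndependentOfCardEqFinrank hb (by simp [hV])
  have he : ∀ i, e i = b i := fun i => by simp [e]
  have he0 : e 0 = v := (he 0).trans (hbv 0)
  have he1 : e 1 = w := (he 1).trans (hbv 1)
  have hv0 : v ≠ 0 := hvw.ne_zero 0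
  refine hφ v hv0 (KForm.eq_of_apply_basis e ?_)
  have hperm : ∀ f : Fin 3 → V, ∀ l m, f l = v → f m = w → φ f = 0 := by
    intro f l m hl hm
    have hlm : l ≠ m := by
      rintro rfl
      exact hvw.injective.ne (zero_ne_one (α := Fin 2)) (hl.symm.trans hm)
    obtain ⟨σ, h0, h1⟩ : ∃ σ : Perm (Fin 3), σ 0 = l ∧ σ 1 = m := by
      clear hl hm
      revert l m
      decide +kernel
    have h2 := KForm.map_perm_basis φ f σ
    have h3 : (fun i => f (σ i)) = ![v, w, f (σ 2)] := by
      ext i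
      fin_cases i <;> simp [h0, h1, hl, hm]
    rw [h3, h] at h2
    rcases Int.units_eq_one_or (sign σ) with hs | hs <;> simpa [hs] using h2.symm
  have hv : ∀ u, contract v φ ![v, u] = 0 := fun u =>
    φ.map_eq_zero_of_eq _ (i := 0) (j := 1) rfl (by decide)
  have hw : ∀ u, contract v φ ![w, u] = 0 := h
  rw [AlternatingMap.zero_apply, sevenForm]
  rw [KForm.wedge_eq_zero_four_three]
  -- If `v` or `w` is an argument of the 4-form `(v ⌟ φ) ∧ (v ⌟ φ)`, that factor vanishes because
  -- both lie in the kernel of `v ⌟ φ`. Otherwise both are arguments of the last factor `φ`.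
  intro σ
  obtain ⟨s, hs⟩ : ∃ s, finSumFinEquiv (σ s) = (0 : Fin 7) :=
    ⟨σ.symm (finSumFinEquiv.symm (0 : Fin 7)), by simp⟩
  obtain ⟨t, ht⟩ : ∃ s, finSumFinEquiv (σ s) = (1 : Fin 7) :=
    ⟨σ.symm (finSumFinEquiv.symm (1 : Fin 7)), by simp⟩
  rcases s with l | l
  · exact Or.inl (wedge_self_eq_zero_of_mem_ker hv _ (k := l) (by rw [hs, he0]))
  rcases t with m | m
  · exact Or.inl (wedge_self_eq_zero_of_mem_ker hw _ (k := m) (by rw [ht, he1]))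
  · exact Or.inr (hperm _ l m (by rw [hs, he0]) (by rw [ht, he1]))

end OrthonormalBases

/-! ### Coclosedness with a two-dimensional derived algebra forces a central summand. -/

section Obstruction
variable {L : Type*} [LieRing L] [LieAlgebra ℝ L]

/-- Pulled back to `ℝᵏ` along `v`, a `k`-form is a multiple of the determinant, with factor `α v`.
-/
theorem KForm.eq_zero_of_mem_span {V : Type*} [AddCommGroup V] [Module ℝ V] {k : ℕ}
    (α : KForm V k) {v y : Fin k → V} (hv : α v = 0)
    (hy : ∀ i, y i ∈ Submodule.span ℝ (Set.range v)) : α y = 0 := by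
  choose c hc using fun i => (Submodule.mem_span_range_iff_exists_fun ℝ).mp (hy i)
  have h1 : α.compLinearMap (Fintype.linearCombination ℝ v) = 0 := by
    rw [AlternatingMap.eq_smul_basis_det (Pi.basisFun ℝ (Fin k))
      (α.compLinearMap (Fintype.linearCombination ℝ v))]
    have : α.compLinearMap (Fintype.linearCombination ℝ v) (Pi.basisFun ℝ (Fin k)) = α v := by
      rw [AlternatingMap.compLinearMap_apply]
      congr 1
      ext i
      simp [Fintype.linearCombination_apply, Pi.single_apply]
    rw [this, hv, zero_smul]
  have h2 := congrArg (fun β => β c) h1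
  simpa [Fintype.linearCombination_apply, hc] using h2

theorem repr_lie_eq_zero [FiniteDimensional ℝ L] {C : Submodule ℝ L} (hder : ∀ x y : L, ⁅x, y⁆ ∈ C)
    {b : Module.Basis (Fin 7) ℝ L} (hb : ∀ i : Fin 7, i.val < Module.finrank ℝ C → b i ∈ C)
    (x y : L) {a : Fin 7} (ha : Module.finrank ℝ C ≤ a.val) : b.repr ⁅x, y⁆ a = 0 :=
  repr_eq_zero_of_mem b hb (hder x y) ha

/-- This provides the hypothesis `cⁱᵢⱼ = 0` of the symmetry criterion: either `bᵢ` is central, or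
brackets have no component along `bᵢ`. -/
theorem repr_lie_left_eq_zero [FiniteDimensional ℝ L] {C : Submodule ℝ L}
    (hder : ∀ x y : L, ⁅x, y⁆ ∈ C) (hcen : ∀ c ∈ C, ∀ y : L, ⁅c, y⁆ = 0)
    {b : Module.Basis (Fin 7) ℝ L} (hb : ∀ i : Fin 7, i.val < Module.finrank ℝ C → b i ∈ C)
    (i j : Fin 7) : b.repr ⁅b i, b j⁆ i = 0 := by
  by_cases hi : i.val < Module.finrank ℝ C
  · simp [hcen _ (hb i hi)]
  · exact repr_lie_eq_zero hder hb _ _ (not_lt.mp hi)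

theorem Induces.vol_apply_ne_zero {V : Type*} [AddCommGroup V] [Module ℝ V] {φ : KForm V 3}
    {g : LinearMap.BilinForm ℝ V} {vol : KForm V 7} (h : Induces φ g vol)
    (b : Module.Basis (Fin 7) ℝ V) : vol b ≠ 0 := by
  intro hb
  obtain ⟨e, -, he⟩ := h.volume
  rw [KForm.eq_of_apply_basis (β := 0) b hb] at he
  simp at he

theorem mem_of_repr_eq_zero {V : Type*} [AddCommGroup V] [Module ℝ V]
    (b : Module.Basis (Fin 7) ℝ V) {v : V} {k : ℕ}
    (hv : ∀ i : Fin 7, k ≤ i.val → b.repr v i = 0) {S : Submodule ℝ V}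
    (hS : ∀ i : Fin 7, i.val < k → b i ∈ S) : v ∈ S := by
  rw [← b.sum_repr v]
  refine Submodule.sum_mem _ fun i _ => ?_
  by_cases hi : i.val < k
  · exact S.smul_mem _ (hS i hi)
  · rw [hv i (not_lt.mp hi), zero_smul]
    exact S.zero_mem

theorem KForm.swap_zero_three {V : Type*} [AddCommGroup V] [Module ℝ V] (ψ : KForm V 4)
    (x y z w : V) : ψ ![w, y, z, x] = -ψ ![x, y, z, w] := by
  rw [← ψ.map_swap _ (show (0 : Fin 4) ≠ 3 by decide)]
  congr 1
  ext i
  fin_cases i <;> rfl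

/-- A skew-symmetric form whose radical contains a plane `D` of a `7`-dimensional space has a vector
outside `D` in its radical. -/
theorem exists_radical_notMem {V : Type*} [AddCommGroup V] [Module ℝ V]
    (hV : Module.finrank ℝ V = 7) (β : V →ₗ[ℝ] V →ₗ[ℝ] ℝ) (hβ : ∀ x y, β x y = -β y x)
    {D : Submodule ℝ V} (hD : Module.finrank ℝ D = 2) {e : Module.Basis (Fin 7) ℝ V}
    (heD : ∀ i : Fin 7, i.val < 2 → e i ∈ D) (hβD : ∀ d ∈ D, ∀ y, β d y = 0) :
    ∃ x, x ∉ D ∧ ∀ y, β x y = 0 := by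
  have : FiniteDimensional ℝ V := Module.finite_of_finrank_pos (by omega)
  -- Modulo `D` the form lives on five dimensions, and a skew matrix of odd size is singular.
  obtain ⟨c, hc0, hc⟩ := exists_mulVec_eq_zero_of_skew (by decide : Odd 5)
    (Matrix.of fun i j : Fin 5 => β (e (Fin.natAdd 2 j)) (e (Fin.natAdd 2 i))) (by
      ext i j
      exact hβ _ _)
  set x := ∑ i : Fin 5, c i • e (Fin.natAdd 2 i) with hx
  have hxe : ∀ a, β x (e a) = 0 := by
    refine Fin.addCases (m := 2) (n := 5) (fun a => ?_) (fun i => ?_)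
    · rw [hβ, hβD _ (heD _ a.isLt), neg_zero]
    · have h := congrFun hc i
      simp only [Matrix.mulVec, dotProduct, Matrix.of_apply, Pi.zero_apply] at h
      rw [← h, hx, map_sum, LinearMap.sum_apply]
      exact Finset.sum_congr rfl fun j _ => by
        rw [map_smul, LinearMap.smul_apply, smul_eq_mul, mul_comm]
  refine ⟨x, fun hxD => hc0 (funext fun i => ?_), fun y => ?_⟩
  · have hij : ∀ j : Fin 5, (Fin.natAdd 2 j : Fin 7) = Fin.natAdd 2 i ↔ j = i :=
      fun j => (Fin.natAdd_injective 5 2).eq_iff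
    have hxrepr : e.repr x (Fin.natAdd 2 i) = c i := by
      rw [hx]
      simp [Finsupp.single_apply, hij]
    rw [← hxrepr, repr_eq_zero_of_mem e (U := D) (by rwa [hD]) hxD (by simp [hD])]
    rfl
  · rw [← e.sum_repr y, map_sum]
    exact Finset.sum_eq_zero fun a _ => by rw [map_smul, hxe, smul_zero]

/-- An orthonormal basis `b` with `b₀, b₁` spanning a plane `D`, such that the restriction of `φ` to
the span of `b₃, …, b₆` vanishes. -/
theorem exists_orthonormalBasis_vanishing {V : Type*} [AddCommGroup V] [Module ℝ V]
    (hV : Module.finrank ℝ V = 7) {φ : KForm V 3} {g : LinearMap.BilinForm ℝ V} {vol : KForm V 7}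
    {ψ : KForm V 4} (hind : Induces φ g vol) (hψ : IsHodgeDual g vol φ ψ) {D : Submodule ℝ V}
    (hD : Module.finrank ℝ D = 2) :
    ∃ b : Module.Basis (Fin 7) ℝ V, IsOrthonormalBasis g b ∧ b 0 ∈ D ∧ b 1 ∈ D ∧
      ∀ j k l : Fin 7, 3 ≤ j → 3 ≤ k → 3 ≤ l → φ ![b j, b k, b l] = 0 := by
  have : FiniteDimensional ℝ V := Module.finite_of_finrank_pos (by omega)
  obtain ⟨e, he, heD, -⟩ := exists_orthonormalBasis_flag hind.inner hV (le_refl D)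
  rw [hD] at heD
  -- The skew form `ψ (·, e₀, e₁, ·)` has `D` in its radical. A further radical vector `x` completes
  -- `D` to an associative 3-plane.
  obtain ⟨x, hxD, hψx⟩ : ∃ x, x ∉ D ∧ ∀ u, ψ ![x, e 0, e 1, u] = 0 := by
    refine exists_radical_notMem hV (LinearMap.mk₂ ℝ (fun x u => ψ ![x, e 0, e 1, u])
      (fun x y u => congrArg (fun α : KForm V 3 => α ![e 0, e 1, u]) (contract_add x y ψ))
      (fun c x u => congrArg (fun α : KForm V 3 => α ![e 0, e 1, u]) (contract_smul c x ψ))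
      (fun x u v => ?_) (fun c x u => ?_)) (fun x u => KForm.swap_zero_three _ _ _ _ _) hD heD ?_
    · rw [KForm.swap_zero_three, KForm.swap_zero_three ψ u, KForm.swap_zero_three ψ v, ← neg_add]
      exact congrArg (fun α : KForm V 3 => -α ![e 0, e 1, x]) (contract_add u v ψ)
    · rw [KForm.swap_zero_three, KForm.swap_zero_three ψ u, smul_neg]
      exact congrArg (fun α : KForm V 3 => -α ![e 0, e 1, x]) (contract_smul c u ψ)
    · intro d hd u
      have hd' : d = ∑ i : Fin 2, e.repr d (i.castLE (by norm_num)) • e (i.castLE (by norm_num)) := by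
        conv_lhs => rw [← e.sum_repr d]
        rw [Fin.sum_univ_add (a := 2) (b := 5),
          Finset.sum_eq_zero (s := (Finset.univ : Finset (Fin 5)))
          fun i _ => by
            rw [repr_eq_zero_of_mem e (U := D) (by rwa [hD]) hd (by simp [hD]), zero_smul], add_zero]
        rfl
      change ψ ![d, e 0, e 1, u] = 0
      rw [hd', apply_vecCons_sum]
      refine Finset.sum_eq_zero fun i _ => ?_
      rw [apply_vecCons_smul]
      refine mul_eq_zero_of_right _ ?_
      fin_cases i
      · exact ψ.map_eq_zero_of_eq _ (i := 0) (j := 1) rfl (by decide)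
      · exact ψ.map_eq_zero_of_eq _ (i := 0) (j := 2) rfl (by decide)
  have hx0 : x ≠ 0 := fun h => hxD (h ▸ D.zero_mem)
  have hW : Module.finrank ℝ (D ⊔ Submodule.span ℝ {x} : Submodule ℝ V) = 3 := by
    have h1 := Submodule.finrank_sup_add_finrank_inf_eq D (Submodule.span ℝ {x})
    rw [(Submodule.disjoint_span_singleton' hx0).mpr hxD |>.eq_bot, finrank_span_singleton hx0] at h1
    simpa [hD] using h1
  obtain ⟨b, hb, hbD, hbW⟩ := exists_orthonormalBasis_flag hind.inner hV
    (le_sup_left : D ≤ D ⊔ Submodule.span ℝ {x})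
  rw [hD] at hbD
  rw [hW] at hbW
  refine ⟨b, hb, hbD 0 (by simp), hbD 1 (by simp), ?_⟩
  have hDspan : D ≤ Submodule.span ℝ (Set.range ![x, e 0, e 1]) := by
    intro d hd
    refine mem_of_repr_eq_zero e (k := 2) (fun i hi => ?_) fun i hi => ?_
    · exact repr_eq_zero_of_mem e (U := D) (by rwa [hD]) hd (by rwa [hD])
    · obtain rfl | rfl : i = 0 ∨ i = 1 := by omega
      · exact Submodule.subset_span ⟨1, rfl⟩
      · exact Submodule.subset_span ⟨2, rfl⟩
  have hWspan : D ⊔ Submodule.span ℝ {x} ≤ Submodule.span ℝ (Set.range ![x, e 0, e 1]) := by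
    refine sup_le hDspan ?_
    rw [Submodule.span_singleton_le_iff_mem]
    exact Submodule.subset_span ⟨0, rfl⟩
  have hψb : ∀ u, ψ ![u, b 0, b 1, b 2] = 0 := by
    intro u
    have h1 : contract u ψ ![x, e 0, e 1] = 0 := by
      refine Eq.trans ?_ (neg_eq_zero.mpr (hψx u))
      refine Eq.trans ?_ (KForm.swap_zero_three _ _ _ _ _)
      have h2 := KForm.map_perm_basis ψ ![u, x, e 0, e 1] (swap 1 2 * swap 2 3)
      rw [show sign (swap 1 2 * swap 2 3 : Perm (Fin 4)) = 1 by decide +kernel] at h2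
      simp only [Units.val_one, Int.cast_one, one_mul] at h2
      refine Eq.trans h2.symm ?_
      congr 1
      ext i
      fin_cases i <;> rfl
    refine KForm.eq_zero_of_mem_span (contract u ψ) h1 fun i => hWspan ?_
    fin_cases i
    · exact hbW 0 (by simp)
    · exact hbW 1 (by simp)
    · exact hbW 2 (by simp)
  intro j k l hj hk hl
  by_cases hjk : j = k
  · exact φ.map_eq_zero_of_eq _ (i := 0) (j := 1) (by rw [hjk]; rfl) (by decide)
  by_cases hjl : j = l
  · exact φ.map_eq_zero_of_eq _ (i := 0) (j := 2) (by rw [hjl]; rfl) (by decide)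
  by_cases hkl : k = l
  · exact φ.map_eq_zero_of_eq _ (i := 1) (j := 2) (by rw [hkl]; rfl) (by decide)
  have hinj : ∀ j k l : Fin 7, (3 ≤ j ∧ 3 ≤ k ∧ 3 ≤ l ∧ j ≠ k ∧ j ≠ l ∧ k ≠ l) →
      Function.Injective (![j, k, l, 0, 1, 2] : Fin 6 → Fin 7) := by decide +kernel
  have hP := Equiv.Perm.isMultiplyPretransitive (Fin 7) 6
  rw [MulAction.isMultiplyPretransitive_iff] at hP
  -- Position `3` is left free and receives the remaining index. Hodge duality then equates `φ (b_j,
  -- b_k, b_l)`, up to a nonzero factor, with a value `ψ (·, b₀, b₁, b₂) = 0`.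
  obtain ⟨σ, hσ⟩ := hP ⟨![0, 1, 2, 4, 5, 6], by decide⟩
    ⟨![j, k, l, 0, 1, 2], hinj j k l ⟨hj, hk, hl, hjk, hjl, hkl⟩⟩
  have hσ' : ∀ i : Fin 6, σ (![0, 1, 2, 4, 5, 6] i) = ![j, k, l, 0, 1, 2] i := fun i =>
    congrArg (fun f : Fin 6 ↪ Fin 7 => f i) hσ
  have h1 := hψ.apply_perm hb σ
  rw [show σ 4 = 0 from hσ' 3, show σ 5 = 1 from hσ' 4, show σ 6 = 2 from hσ' 5, hψb,
    show σ 0 = j from hσ' 0, show σ 1 = k from hσ' 1, show σ 2 = l from hσ' 2] at h1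
  have hs : ((sign σ : ℤ) : ℝ) ≠ 0 := by exact_mod_cast (sign σ).ne_zero
  exact (mul_eq_zero.mp h1.symm).resolve_left (mul_ne_zero hs (hind.vol_apply_ne_zero b))

/-- If `φ` vanishes on the span of `b₃, …, b₆`, then the component `cᵃ (b₂, ·)` of the Lie bracket of a
coclosed `G₂`-structure vanishes. -/
theorem repr_lie_two_eq_zero (hL : Module.finrank ℝ L = 7) {φ : KForm L 3} (hφ : IsG2Structure φ)
    {g : LinearMap.BilinForm ℝ L} (hg : IsInnerProduct g) {b : Module.Basis (Fin 7) ℝ L}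
    (h3 : ∀ j k l : Fin 7, 3 ≤ j → 3 ≤ k → 3 ≤ l → φ ![b j, b k, b l] = 0)
    (h0 : ∀ y : L, ⁅b 0, y⁆ = 0) (h1 : ∀ y : L, ⁅b 1, y⁆ = 0) {a : Fin 7}
    (hS : ∀ c : Fin 7, 3 ≤ c → structureSum φ b a c = 0) (j : Fin 7) :
    b.repr ⁅b 2, b j⁆ a = 0 := by
  have : FiniteDimensional ℝ L := Module.finite_of_finrank_pos (by omega)
  have h0' : ∀ y : L, ⁅y, b 0⁆ = 0 := fun y => by rw [← lie_skew, h0, neg_zero]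
  have h1' : ∀ y : L, ⁅y, b 1⁆ = 0 := fun y => by rw [← lie_skew, h1, neg_zero]
  set ζ : Fin 7 → ℝ := fun j => b.repr ⁅b 2, b j⁆ a with hζ
  set z := ∑ j, ζ j • b j with hz
  have hζ0 : ζ 0 = 0 := by simp [hζ, h0']
  have hζ1 : ζ 1 = 0 := by simp [hζ, h1']
  have hζ2 : ζ 2 = 0 := by simp [hζ]
  have hφz : ∀ u v, φ ![z, u, v] = ∑ j, ζ j * φ ![b j, u, v] := by
    intro u v
    rw [hz, apply_vecCons_sum]
    simp only [apply_vecCons_smul]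
  have hφ01 : ∀ x y w, φ ![x, y, w] = -φ ![y, x, w] := fun x y w =>
    congrArg (fun α => α ![w]) (contract_swap y x φ)
  have hφ12 : ∀ x y w, φ ![x, y, w] = -φ ![x, w, y] := fun x y w =>
    congrArg (fun α => α ![]) (contract_swap w y (contract x φ))
  have hcyc : ∀ x y w, φ ![x, y, w] = φ ![y, w, x] := fun x y w => by rw [hφ01, hφ12, neg_neg]
  have hφ02 : ∀ x y w, φ ![x, y, w] = -φ ![w, y, x] := fun x y w => by rw [hcyc, hφ01]
  have hcase : ∀ i : Fin 7, i = 0 ∨ i = 1 ∨ i = 2 ∨ 3 ≤ i := by decide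
  -- In the structure sum with `c ≥ 3`, indices `0, 1` contribute nothing because `b₀, b₁` are
  -- central, and pairs of indices `≥ 3` nothing by `h3`. Only pairs containing `2` remain, and they
  -- add up to a multiple of `φ (z, b₂, b_c)`.
  have hz2 : ∀ c : Fin 7, 3 ≤ c → φ ![z, b 2, b c] = 0 := by
    intro c hc
    have hsum : structureSum φ b a c = ∑ i, ∑ j,
        ((if i = 2 then ζ j * φ ![b c, b 2, b j] else 0) +
          if j = 2 then ζ i * φ ![b c, b 2, b i] else 0) := by
      refine Finset.sum_congr rfl fun i _ => Finset.sum_congr rfl fun j _ => ?_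
      by_cases hi : i = 2
      · subst hi
        by_cases hj : j = 2
        · subst hj
          simp [hζ2]
        · simp [hj, hζ]
      · by_cases hj : j = 2
        · subst hj
          rw [if_neg hi, if_pos rfl, zero_add, repr_lie_skew, hφ12]
          simp [hζ]
        · rw [if_neg hi, if_neg hj, add_zero]
          rcases hcase i with rfl | rfl | rfl | hi3
          · simp [h0]
          · simp [h1]
          · exact absurd rfl hi
          rcases hcase j with rfl | rfl | rfl | hj3
          · simp [h0']
          · simp [h1']
          · exact absurd rfl hj
          rw [h3 c i j hc hi3 hj3, mul_zero]
    have h5 : structureSum φ b a c = 2 * ∑ j, ζ j * φ ![b c, b 2, b j] := by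
      rw [hsum]
      simp only [Finset.sum_add_distrib, Finset.sum_ite_eq', Finset.mem_univ, if_true]
      rw [Finset.sum_comm]
      simp only [Finset.sum_ite_eq', Finset.mem_univ, if_true]
      ring
    rw [hS c hc] at h5
    rw [hφz]
    have h6 : ∀ j, φ ![b j, b 2, b c] = -φ ![b c, b 2, b j] := fun j => hφ02 _ _ _
    simp only [h6, mul_neg, Finset.sum_neg_distrib]
    linarith
  have hz3 : ∀ c d : Fin 7, 3 ≤ c → 3 ≤ d → φ ![z, b c, b d] = 0 := by
    intro c d hc hd
    rw [hφz]
    refine Finset.sum_eq_zero fun j _ => ?_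
    rcases hcase j with rfl | rfl | rfl | hj3
    · rw [hζ0, zero_mul]
    · rw [hζ1, zero_mul]
    · rw [hζ2, zero_mul]
    · rw [h3 j c d hj3 hc hd, mul_zero]
  have hzz : ∀ c d : Fin 7, 2 ≤ c → 2 ≤ d → φ ![z, b c, b d] = 0 := by
    have hcase2 : ∀ i : Fin 7, 2 ≤ i → i = 2 ∨ 3 ≤ i := by decide
    intro c d hc hd
    rcases hcase2 c hc with rfl | hc <;> rcases hcase2 d hd with rfl | hd
    · exact φ.map_eq_zero_of_eq _ (i := 1) (j := 2) rfl (by decide)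
    · exact hz2 d hd
    · rw [hφ12, hz2 c hc, neg_zero]
    · exact hz3 c d hc hd
  suffices hz0 : z = 0 by
    have h := congrArg (fun x => b.repr x j) hz0
    simpa [hz, Finsupp.single_apply] using h
  by_contra hz0
  -- By `hzz`, the form `z ⌟ φ` vanishes on the five-dimensional span of `b₂, …, b₆`. Three linear
  -- conditions leave a nonzero `Y u` there: two make `φ (z, Y u, ·)` vanish on `b₀, b₁` as well,
  -- and orthogonality to `z` gives independence. This contradicts that `z` spans the kernel of `z ⌟
  -- φ`.
  let T : L →ₗ[ℝ] Fin 3 → ℝ := LinearMap.pi ![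
    { toFun := fun y => φ ![y, z, b 0]
      map_add' := fun x y => congrArg (fun α : KForm L 2 => α ![z, b 0]) (contract_add x y φ)
      map_smul' := fun c x => congrArg (fun α : KForm L 2 => α ![z, b 0]) (contract_smul c x φ) },
    { toFun := fun y => φ ![y, z, b 1]
      map_add' := fun x y => congrArg (fun α : KForm L 2 => α ![z, b 1]) (contract_add x y φ)
      map_smul' := fun c x => congrArg (fun α : KForm L 2 => α ![z, b 1]) (contract_smul c x φ) },
    g z]
  let Y : (Fin 5 → ℝ) →ₗ[ℝ] L := Fintype.linearCombination ℝ fun i : Fin 5 => b (Fin.natAdd 2 i)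
  have hker : (T ∘ₗ Y).ker ≠ ⊥ := LinearMap.ker_ne_bot_of_finrank_lt (by simp)
  obtain ⟨u, hu, hu0⟩ := Submodule.exists_mem_ne_zero_of_ne_bot hker
  have hY : LinearIndependent ℝ fun i : Fin 5 => b (Fin.natAdd 2 i) :=
    b.linearIndependent.comp _ (Fin.natAdd_injective 5 2)
  have hYu : Y u ≠ 0 := fun h => hu0 (by
    have := Fintype.linearIndependent_iff.mp hY u
      (by rwa [Fintype.linearCombination_apply] at h)
    exact funext this)
  have hT : ∀ i, T (Y u) i = 0 := fun i => congrFun (LinearMap.mem_ker.mp hu) i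
  have hT0 : φ ![Y u, z, b 0] = 0 := hT 0
  have hT1 : φ ![Y u, z, b 1] = 0 := hT 1
  have hT2 : g z (Y u) = 0 := hT 2
  refine hφ.not_linearIndependent hL (v := z) (w := Y u) ?_ fun v => ?_
  · rw [LinearIndependent.pair_iff]
    intro s t hst
    have hs : s = 0 := by
      have h := congrArg (g z) hst
      simp only [map_add, map_smul, smul_eq_mul, hT2, mul_zero, add_zero, map_zero] at h
      exact (mul_eq_zero.mp h).resolve_right (hg.pos z hz0).ne'
    subst hs
    rw [zero_smul, zero_add] at hst
    exact ⟨rfl, (smul_eq_zero.mp hst).resolve_right hYu⟩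
  · have hv : φ ![v, z, Y u] = 0 := by
      rw [apply_vecCons_eq_sum_repr b]
      refine Finset.sum_eq_zero fun c _ => ?_
      have : φ ![b c, z, Y u] = 0 := by
        refine Fin.addCases (m := 2) (n := 5) (fun c => ?_) (fun c => ?_) c
        · fin_cases c
          · exact (hφ02 _ _ _).trans (by rw [neg_eq_zero]; exact hT0)
          · exact (hφ02 _ _ _).trans (by rw [neg_eq_zero]; exact hT1)
        · have hYsum : Y u = ∑ i : Fin 5, u i • b (Fin.natAdd 2 i) :=
            Fintype.linearCombination_apply ..
          rw [← hcyc, hYsum, apply_vecCons_sum]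
          refine Finset.sum_eq_zero fun i _ => ?_
          rw [apply_vecCons_smul, ← hcyc, hzz _ _ (by simp [Fin.le_def]) (by simp [Fin.le_def]),
            mul_zero]
      rw [this, mul_zero]
    rw [← hcyc, hv]

theorem lie_mem_derivedAlgebra (x y : L) : ⁅x, y⁆ ∈ (derivedAlgebra L).toSubmodule :=
  LieSubmodule.lie_mem_lie (LieSubmodule.mem_top x) (LieSubmodule.mem_top y)

theorem IsTwoStepNilpotent.lie_eq_zero (hL : IsTwoStepNilpotent L) :
    ∀ c ∈ (derivedAlgebra L).toSubmodule, ∀ y : L, ⁅c, y⁆ = 0 := by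
  intro c hc y
  rw [← lie_skew, (LieModule.mem_maxTrivSubmodule ℝ L L c).mp (hL.2 hc) y, neg_zero]

/-- Choose a linear functional that is nonzero at `x` and zero on the derived algebra. Its kernel is
an ideal, since it contains all brackets, and is a complement of the line through `x`; it is nonzero
because the algebra is not abelian. -/
theorem IsReducibleLie.of_central {x : L} (hx : ∀ y : L, ⁅x, y⁆ = 0)
    (hxD : x ∉ (derivedAlgebra L).toSubmodule) (hab : ¬ IsLieAbelian L) : IsReducibleLie L := by
  obtain ⟨f, hfx, hf⟩ := Submodule.exists_le_ker_of_notMem hxD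
  have hx' : ∀ y : L, ⁅y, x⁆ = 0 := fun y => by rw [← lie_skew, hx, neg_zero]
  let I : LieIdeal ℝ L :=
    { Submodule.span ℝ {x} with
      lie_mem := by
        intro y m hm
        obtain ⟨c, rfl⟩ := Submodule.mem_span_singleton.mp hm
        change ⁅y, c • x⁆ ∈ Submodule.span ℝ {x}
        rw [lie_smul, hx', smul_zero]
        exact Submodule.zero_mem _ }
  let J : LieIdeal ℝ L :=
    { f.ker with
      lie_mem := fun {y m} _ => hf (lie_mem_derivedAlgebra y m) }
  have hI : I.toSubmodule = Submodule.span ℝ {x} := rfl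
  have hJ : J.toSubmodule = f.ker := rfl
  have hIJ : IsCompl I J := by
    rw [← LieSubmodule.isCompl_toSubmodule, hI, hJ]
    constructor
    · rw [Submodule.disjoint_def]
      intro y hy hfy
      obtain ⟨c, rfl⟩ := Submodule.mem_span_singleton.mp hy
      rw [LinearMap.mem_ker, map_smul, smul_eq_mul] at hfy
      rw [(mul_eq_zero.mp hfy).resolve_right hfx, zero_smul]
    · rw [codisjoint_iff, eq_top_iff]
      intro y _
      refine Submodule.mem_sup.mpr ⟨(f y / f x) • x, Submodule.smul_mem _ _
        (Submodule.mem_span_singleton_self x), y - (f y / f x) • x, ?_, by abel⟩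
      rw [LinearMap.mem_ker, map_sub, map_smul, smul_eq_mul, div_mul_cancel₀ _ hfx, sub_self]
  refine ⟨I, J, ?_, ?_, hIJ⟩
  · intro h
    have hxI : x ∈ I := Submodule.mem_span_singleton_self x
    rw [h] at hxI
    have hx0 : x = 0 := by simpa using hxI
    exact hxD (hx0 ▸ Submodule.zero_mem _)
  · intro h
    refine hab ⟨fun y z => ?_⟩
    have hJm : ⁅y, z⁆ ∈ J := hf (lie_mem_derivedAlgebra y z)
    rw [h] at hJm
    simpa using hJm

/-- A coclosed `G₂`-structure forces a central element outside a two-dimensional derived algebra. -/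
theorem exists_central_of_coclosed (hL : Module.finrank ℝ L = 7) (hn : IsTwoStepNilpotent L)
    (hD : Module.finrank ℝ (derivedAlgebra L) = 2) {φ : KForm L 3} (hφ : IsCoclosedG2Structure φ) :
    ∃ x : L, (∀ y : L, ⁅x, y⁆ = 0) ∧ x ∉ (derivedAlgebra L).toSubmodule := by
  have : FiniteDimensional ℝ L := Module.finite_of_finrank_pos (by omega)
  obtain ⟨hG2, g, vol, ψ, hind, hψ, hd⟩ := hφ
  set D := (derivedAlgebra L).toSubmodule with hDdef
  replace hD : Module.finrank ℝ D = 2 := hD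
  have hcen := hn.lie_eq_zero
  obtain ⟨b, hb, hb0, hb1, h3⟩ := exists_orthonormalBasis_vanishing hL hind hψ hD
  have hbD : ∀ i : Fin 7, i.val < Module.finrank ℝ D → b i ∈ D := by
    intro i hi
    rw [hD] at hi
    obtain rfl | rfl : i = 0 ∨ i = 1 := by omega
    · exact hb0
    · exact hb1
  have hc := repr_lie_left_eq_zero lie_mem_derivedAlgebra hcen hbD
  have hzero : ∀ (x y : L) (a : Fin 7), 2 ≤ a.val → b.repr ⁅x, y⁆ a = 0 := fun x y a ha =>
    repr_lie_eq_zero lie_mem_derivedAlgebra hbD x y (hD.trans_le ha)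
  have hS := (ceDifferential_eq_zero_iff hψ hb (hind.vol_apply_ne_zero b) hc).mp hd
  -- Symmetry turns column `c` into row `c`, which vanishes because brackets lie in the span of `b₀,
  -- b₁`.
  have hSz : ∀ a c : Fin 7, 3 ≤ c → structureSum φ b a c = 0 := by
    intro a c hca
    have hc2 : 2 ≤ c.val := le_trans (by norm_num) (Fin.le_def.mp hca)
    rw [hS]
    refine Finset.sum_eq_zero fun i _ => Finset.sum_eq_zero fun j _ => ?_
    rw [hzero _ _ _ hc2, zero_mul]
  refine ⟨b 2, fun y => ?_, fun h => ?_⟩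
  · have hj : ∀ j, ⁅b 2, b j⁆ = 0 := by
      intro j
      refine b.ext_elem fun a => ?_
      rw [repr_lie_two_eq_zero hL hG2 hind.inner h3 (hcen _ hb0) (hcen _ hb1) (hSz a), map_zero,
        Finsupp.zero_apply]
    rw [← b.sum_repr y, lie_sum]
    exact Finset.sum_eq_zero fun j _ => by rw [lie_smul, hj, smul_zero]
  · have h2 := repr_eq_zero_of_mem b hbD h (i := 2) (by simp [hD])
    simp at h2

end Obstruction

/-! ### Coclosed structures from central subspaces of dimension three and one. -/

section Existence
variable {L : Type*} [LieRing L] [LieAlgebra ℝ L]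

theorem stdForm_apply (b : Module.Basis (Fin 7) ℝ L) (c i j : Fin 7) :
    stdForm b ![b c, b i, b j] = stdCoeff c i j := by
  refine Eq.trans ?_ (stdForm_apply_basis b ![c, i, j])
  congr 1
  ext k
  fin_cases k <;> rfl

theorem exists_coclosed_of_structureSum_symm {g : LinearMap.BilinForm ℝ L} (hg : IsInnerProduct g)
    {b : Module.Basis (Fin 7) ℝ L} (hb : IsOrthonormalBasis g b)
    (hc : ∀ i j, b.repr ⁅b i, b j⁆ i = 0)
    (hS : ∀ a c, structureSum (stdForm b) b a c = structureSum (stdForm b) b c a) :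
    ∃ φ : KForm L 3, IsCoclosedG2Structure φ ∧ IsInducedMetric φ g := by
  have hind := Induces.of_stdForm hg hb
  have hψ := IsHodgeDual.of_starExpr hg hb b.det (stdForm b)
  exact ⟨stdForm b, ⟨hind.isG2Structure, g, b.det, _, hind, hψ,
    (ceDifferential_eq_zero_iff hψ hb (hind.vol_apply_ne_zero b) hc).mpr hS⟩, b.det, hind⟩

/-- Make `C` the associative plane `b₀, b₁, b₂`. Its complement is coassociative, so the matrix of
structure sums is supported in a 3 × 3 block `A`. Rotating `C` by `R` leaves all brackets of basis
vectors unchanged (`hlie`) and replaces `A` by `R A`. The space `C` may be larger than the derived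
algebra, as the reducible case requires. -/
theorem exists_coclosed_of_central_three (hL : Module.finrank ℝ L = 7)
    {g : LinearMap.BilinForm ℝ L} (hg : IsInnerProduct g) {C : Submodule ℝ L}
    (hder : ∀ x y : L, ⁅x, y⁆ ∈ C) (hcen : ∀ c ∈ C, ∀ y : L, ⁅c, y⁆ = 0)
    (hC : Module.finrank ℝ C = 3) :
    ∃ φ : KForm L 3, IsCoclosedG2Structure φ ∧ IsInducedMetric φ g := by
  have : FiniteDimensional ℝ L := Module.finite_of_finrank_pos (by omega)
  obtain ⟨e, he, heC, -⟩ := exists_orthonormalBasis_flag hg hL (le_refl C)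
  rw [hC] at heC
  obtain ⟨R, hR, hsymm⟩ := exists_orthogonal_mul_symm (Matrix.of fun a k : Fin 3 =>
    ∑ i, ∑ j, e.repr ⁅e i, e j⁆ (Fin.castAdd 4 a) * (stdCoeff (Fin.castAdd 4 k) i j : ℝ))
  have hRapply : ∀ a c, ∑ d, R a d * R c d = if a = c then 1 else 0 := by
    intro a c
    have h := congrFun (congrFun hR a) c
    rwa [Matrix.mul_apply, Matrix.one_apply] at h
  have h33 : ∀ a c : Fin 3, (Fin.castAdd 4 a : Fin 7) = Fin.castAdd 4 c ↔ a = c := by decide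
  have h34 : ∀ (a : Fin 3) (i : Fin 4), (Fin.castAdd 4 a : Fin 7) = Fin.natAdd 3 i ↔ False := by
    decide
  have h43 : ∀ (i : Fin 4) (a : Fin 3), (Fin.natAdd 3 i : Fin 7) = Fin.castAdd 4 a ↔ False := by
    decide
  obtain ⟨b, hb, hbv⟩ := exists_orthonormalBasis_eq (g := g) hL
    (v := Fin.append (fun a : Fin 3 => ∑ d, R a d • e (Fin.castAdd 4 d))
      (fun i : Fin 4 => e (Fin.natAdd 3 i))) (by
    refine Fin.addCases (m := 3) (n := 4) (fun a => ?_) (fun i => ?_) <;>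
      refine Fin.addCases (m := 3) (n := 4) (fun c => ?_) (fun j => ?_)
    · simp only [Fin.append_left, map_sum, map_smul, LinearMap.sum_apply, LinearMap.smul_apply,
        he _ _, smul_eq_mul, h33, mul_ite, mul_one, mul_zero, Finset.sum_ite_eq',
        Finset.mem_univ, if_true]
      rw [← hRapply]
      exact Finset.sum_congr rfl fun d _ => mul_comm _ _
    · simp only [Fin.append_left, Fin.append_right, map_sum, map_smul, LinearMap.sum_apply,
        LinearMap.smul_apply, he _ _, smul_eq_mul, h34, if_false, mul_zero, Finset.sum_const_zero]
    · simp only [Fin.append_left, Fin.append_right, map_sum, map_smul, he _ _, smul_eq_mul, h43,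
        if_false, mul_zero, Finset.sum_const_zero]
    · simp only [Fin.append_right, he _ _])
  have hb3 : ∀ a : Fin 3, b (Fin.castAdd 4 a) = ∑ d, R a d • e (Fin.castAdd 4 d) := fun a => by
    rw [hbv, Fin.append_left]
  have hb4 : ∀ i : Fin 4, b (Fin.natAdd 3 i) = e (Fin.natAdd 3 i) := fun i => by
    rw [hbv, Fin.append_right]
  have hbC : ∀ i : Fin 7, i.val < Module.finrank ℝ C → b i ∈ C := by
    rw [hC]
    refine Fin.addCases (m := 3) (n := 4) (fun a => ?_) (fun i => ?_)
    · intro _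
      rw [hb3]
      exact Submodule.sum_mem _ fun d _ => C.smul_mem _ (heC _ (by simp))
    · intro h
      simp at h
  have hcen' : ∀ c ∈ C, ∀ y : L, ⁅y, c⁆ = 0 := fun c hc y => by
    rw [← lie_skew, hcen c hc, neg_zero]
  have hlie : ∀ i j, ⁅b i, b j⁆ = ⁅e i, e j⁆ := by
    refine Fin.addCases (m := 3) (n := 4) (fun a => ?_) (fun i => ?_)
    · intro j
      rw [hcen _ (hbC _ (by simp [hC])), hcen _ (heC _ (by simp))]
    · refine Fin.addCases (m := 3) (n := 4) (fun a => ?_) (fun j => ?_)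
      · rw [hcen' _ (hbC _ (by simp [hC])), hcen' _ (heC _ (by simp))]
      · rw [hb4, hb4]
  have hS4 : ∀ (i : Fin 4) c, structureSum (stdForm b) b (Fin.natAdd 3 i) c = 0 := by
    intro i c
    refine Finset.sum_eq_zero fun i _ => Finset.sum_eq_zero fun j _ => ?_
    rw [repr_lie_eq_zero hder hbC _ _ (by simp [hC]), zero_mul]
  have hS3 : ∀ (a : Fin 3) c, structureSum (stdForm b) b (Fin.castAdd 4 a) c =
      ∑ d, R a d * ∑ i, ∑ j, e.repr ⁅e i, e j⁆ (Fin.castAdd 4 d) * (stdCoeff c i j : ℝ) := by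
    intro a c
    have hrep : ∀ x, b.repr x (Fin.castAdd 4 a) = ∑ d, R a d * e.repr x (Fin.castAdd 4 d) := by
      intro x
      simp only [hb.repr_eq, he.repr_eq, hb3, map_sum, map_smul, smul_eq_mul]
    simp only [structureSum, stdForm_apply, hlie, hrep, Finset.sum_mul, Finset.mul_sum, mul_assoc]
    rw [Finset.sum_congr rfl fun i _ => Finset.sum_comm, Finset.sum_comm]
  have hS34 : ∀ (a : Fin 3) (k : Fin 4),
      structureSum (stdForm b) b (Fin.castAdd 4 a) (Fin.natAdd 3 k) = 0 := by
    intro a k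
    rw [hS3]
    refine Finset.sum_eq_zero fun d _ => mul_eq_zero_of_right _ <|
      Finset.sum_eq_zero fun i _ => Finset.sum_eq_zero fun j _ => ?_
    by_cases hi : i.val < 3
    · simp [hcen _ (heC _ hi)]
    by_cases hj : j.val < 3
    · simp [hcen' _ (heC _ hj)]
    have : ∀ (k : Fin 4) (i j : Fin 7), ¬ i.val < 3 → ¬ j.val < 3 →
      stdCoeff (Fin.natAdd 3 k) i j = 0 := by decide +kernel
    rw [this k i j hi hj, Int.cast_zero, mul_zero]
  refine exists_coclosed_of_structureSum_symm hg hb (repr_lie_left_eq_zero hder hcen hbC) ?_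
  refine Fin.addCases (m := 3) (n := 4) (fun a => ?_) (fun i => ?_) <;>
    refine Fin.addCases (m := 3) (n := 4) (fun c => ?_) (fun j => ?_)
  · rw [hS3, hS3]
    have h := congrFun (congrFun hsymm c) a
    rw [Matrix.transpose_apply, Matrix.mul_apply, Matrix.mul_apply] at h
    exact h
  · rw [hS34, hS4]
  · rw [hS34, hS4]
  · rw [hS4, hS4]

/-- The matrix of `e_c ⌟ φ` on the span of `e₁, …, e₆`, for the standard `G₂`-form `φ`. -/
def stdMatrix (c : Fin 7) : Matrix (Fin 6) (Fin 6) ℤ :=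
  Matrix.of fun i j => stdCoeff c i.succ j.succ

/-- The matrix `J` of `e₀ ⌟ φ` is a complex structure, with which the matrices `P` of the other `e_c
⌟ φ` anticommute. If `B` commutes with `J`, then inserting `J² = -1` into `tr (B P)` and moving one
`J` around the trace reverses the sign. -/
theorem sum_mul_stdCoeff_eq_zero {B : Matrix (Fin 6) (Fin 6) ℝ}
    (hB : B * (stdMatrix 0).map (Int.cast : ℤ → ℝ) = (stdMatrix 0).map (Int.cast : ℤ → ℝ) * B)
    (c : Fin 6) : ∑ i, ∑ j, B i j * (stdCoeff c.succ i.succ j.succ : ℝ) = 0 := by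
  have hJ : stdMatrix 0 * stdMatrix 0 = -1 := by decide +kernel
  have hP : ∀ c : Fin 6, (stdMatrix c.succ).transpose * stdMatrix 0 =
    -(stdMatrix 0 * (stdMatrix c.succ).transpose) := by decide +kernel
  set J := (stdMatrix 0).map (Int.cast : ℤ → ℝ) with hJdef
  set P := (stdMatrix c.succ).transpose.map (Int.cast : ℤ → ℝ) with hPdef
  have hJ' : J * J = -1 := by
    have h := congrArg (Int.castRingHom ℝ).mapMatrix hJ
    rwa [map_mul, map_neg, map_one] at h
  have hP' : P * J = -(J * P) := by
    have h := congrArg (Int.castRingHom ℝ).mapMatrix (hP c)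
    rwa [map_neg, map_mul, map_mul] at h
  have htr : ∑ i, ∑ j, B i j * (stdCoeff c.succ i.succ j.succ : ℝ) = (B * P).trace := by
    simp [Matrix.trace, Matrix.mul_apply, hPdef, stdMatrix]
  have h1 : (B * P).trace = -(B * P).trace := by
    calc (B * P).trace = -(B * P * (J * J)).trace := by rw [hJ']; simp
      _ = -(J * B * P * J).trace := by
        rw [← Matrix.mul_assoc, Matrix.trace_mul_comm (B * P * J) J]
        simp only [Matrix.mul_assoc]
      _ = (B * J * J * P).trace := by
        rw [Matrix.mul_assoc _ P J, hP', ← hB]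
        simp [Matrix.mul_assoc]
      _ = -(B * P).trace := by rw [Matrix.mul_assoc B J J, hJ']; simp
  rw [htr]
  linarith

/-- Only row `0` of the matrix of structure sums can be nonzero, so symmetry means `S 0 c = 0` for
`c ≠ 0`. This entry pairs the bracket with `b_c ⌟ φ`, and rotating the complement of `C` makes the
bracket commute with `b₀ ⌟ φ`. -/
theorem exists_coclosed_of_central_one (hL : Module.finrank ℝ L = 7)
    {g : LinearMap.BilinForm ℝ L} (hg : IsInnerProduct g) {C : Submodule ℝ L}
    (hder : ∀ x y : L, ⁅x, y⁆ ∈ C) (hcen : ∀ c ∈ C, ∀ y : L, ⁅c, y⁆ = 0)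
    (hC : Module.finrank ℝ C = 1) :
    ∃ φ : KForm L 3, IsCoclosedG2Structure φ ∧ IsInducedMetric φ g := by
  have : FiniteDimensional ℝ L := Module.finite_of_finrank_pos (by omega)
  obtain ⟨e, he, heC, -⟩ := exists_orthonormalBasis_flag hg hL (le_refl C)
  have he0 : e 0 ∈ C := heC 0 (by simp [hC])
  set A : Matrix (Fin 6) (Fin 6) ℝ :=
    Matrix.of fun i j : Fin 6 => e.repr ⁅e i.succ, e j.succ⁆ 0 with hA
  obtain ⟨R, hR, hcomm⟩ := exists_orthogonal_conj_commute A
    ((stdMatrix 0).map (Int.cast : ℤ → ℝ)) (by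
      ext i j
      exact repr_lie_skew e _ _ _) (by
      have h : (stdMatrix 0).transpose = -stdMatrix 0 := by decide +kernel
      have h' := congrArg (Int.castRingHom ℝ).mapMatrix h
      rwa [map_neg] at h')
  have hRapply : ∀ a c, ∑ d, R a d * R c d = if a = c then 1 else 0 := by
    intro a c
    have h := congrFun (congrFun hR a) c
    rwa [Matrix.mul_apply, Matrix.one_apply] at h
  obtain ⟨b, hb, hbv⟩ := exists_orthonormalBasis_eq (g := g) hL
    (v := Fin.cons (e 0) (fun i : Fin 6 => ∑ k, R i k • e k.succ)) (by
    refine Fin.cases ?_ (fun i => ?_) <;> refine Fin.cases ?_ (fun j => ?_)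
    · simp [he _ _]
    · simp [he _ _, (Fin.succ_ne_zero _).symm]
    · simp [he _ _]
    · simp only [Fin.cons_succ, map_sum, map_smul, LinearMap.sum_apply, LinearMap.smul_apply,
        he _ _, smul_eq_mul, Fin.succ_inj, mul_ite, mul_one, mul_zero,
        Finset.sum_ite_eq', Finset.mem_univ, if_true]
      rw [← hRapply]
      exact Finset.sum_congr rfl fun d _ => mul_comm _ _)
  have hb0 : b 0 = e 0 := by rw [hbv, Fin.cons_zero]
  have hbs : ∀ i : Fin 6, b i.succ = ∑ k, R i k • e k.succ := fun i => by rw [hbv, Fin.cons_succ]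
  have hbC : ∀ i : Fin 7, i.val < Module.finrank ℝ C → b i ∈ C := by
    intro i hi
    obtain rfl : i = 0 := by
      rw [hC] at hi
      omega
    rwa [hb0]
  have hrep : ∀ i j : Fin 6, b.repr ⁅b i.succ, b j.succ⁆ 0 = (R * A * R.transpose) i j := by
    intro i j
    rw [hb.repr_eq, hb0, ← he.repr_eq, hbs, hbs, Matrix.mul_apply]
    simp only [sum_lie, lie_sum, smul_lie, lie_smul, map_sum,
      map_smul, Matrix.mul_apply, Finsupp.coe_finsetSum, Finset.sum_apply, Finsupp.smul_apply,
      smul_eq_mul, Finset.sum_mul, Finset.mul_sum, Matrix.transpose_apply, hA, Matrix.of_apply]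
    refine Finset.sum_congr rfl fun k _ => Finset.sum_congr rfl fun l _ => ?_
    ring
  have hS1 : ∀ (i : Fin 6) c, structureSum (stdForm b) b i.succ c = 0 := by
    intro i c
    refine Finset.sum_eq_zero fun i _ => Finset.sum_eq_zero fun j _ => ?_
    rw [repr_lie_eq_zero hder hbC _ _ (by simp [hC]), zero_mul]
  have hS0 : ∀ c : Fin 6, structureSum (stdForm b) b 0 c.succ = 0 := by
    intro c
    rw [← sum_mul_stdCoeff_eq_zero hcomm c, structureSum, Fin.sum_univ_succ]
    have h0 : ∀ y : L, ⁅b 0, y⁆ = 0 := hcen _ (hb0 ▸ he0)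
    have h0' : ∀ y : L, ⁅y, b 0⁆ = 0 := fun y => by rw [← lie_skew, h0, neg_zero]
    rw [Finset.sum_eq_zero fun j _ => by simp [h0], zero_add]
    refine Finset.sum_congr rfl fun i _ => ?_
    have hi : b.repr ⁅b i.succ, b 0⁆ 0 = 0 := by simp [h0']
    rw [Fin.sum_univ_succ, hi, zero_mul, zero_add]
    simp only [hrep, stdForm_apply]
  refine exists_coclosed_of_structureSum_symm hg hb (repr_lie_left_eq_zero hder hcen hbC) ?_
  refine Fin.cases ?_ (fun i => ?_) <;> refine Fin.cases ?_ (fun j => ?_)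
  · rfl
  · rw [hS0, hS1]
  · rw [hS0, hS1]
  · rw [hS1, hS1]

end Existence

/-! ### Dimension of the derived algebra and the reducible case. -/

section Dimension
variable {L : Type*} [LieRing L] [LieAlgebra ℝ L]

theorem derivedAlgebra_le {S : Submodule ℝ L} (h : ∀ x y : L, ⁅x, y⁆ ∈ S) :
    (derivedAlgebra L).toSubmodule ≤ S := by
  rw [derivedAlgebra, LieSubmodule.lieIdeal_oper_eq_linear_span', Submodule.span_le]
  rintro _ ⟨x, -, y, -, rfl⟩
  exact h x y

theorem lie_eq_zero_of_isCompl {I J : LieIdeal ℝ L} (hIJ : IsCompl I J) {x y : L} (hx : x ∈ I)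
    (hy : y ∈ J) : ⁅x, y⁆ = 0 := by
  have h : ⁅x, y⁆ ∈ I ⊓ J := ⟨lie_mem_left ℝ L I x y hx, lie_mem_right ℝ L J x y hy⟩
  rwa [hIJ.inf_eq_bot, LieSubmodule.mem_bot] at h

theorem exists_add_eq_of_isCompl {I J : LieIdeal ℝ L} (hIJ : IsCompl I J) (x : L) :
    ∃ y ∈ I, ∃ z ∈ J, y + z = x := by
  have h : x ∈ I ⊔ J := by rw [hIJ.sup_eq_top]; exact LieSubmodule.mem_top x
  exact (LieSubmodule.mem_sup I J x).mp h

/-- A direct summand without central elements outside the derived algebra is not abelian. -/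
theorem exists_lie_ne_zero_of_isCompl {I J : LieIdeal ℝ L} (hIJ : IsCompl I J) (hI : I ≠ ⊥)
    (hcen : ∀ x : L, (∀ y : L, ⁅x, y⁆ = 0) → x ∈ (derivedAlgebra L).toSubmodule) :
    ∃ x ∈ I, ∃ y ∈ I, ⁅x, y⁆ ≠ 0 := by
  by_contra! hab
  -- An abelian summand `I` is central, hence inside the derived algebra by `hcen`; but then all
  -- brackets lie in `J`, which meets `I` trivially.
  have hI0 : ∀ x ∈ I, ∀ y : L, ⁅x, y⁆ = 0 := by
    intro x hx y
    obtain ⟨u, hu, v, hv, rfl⟩ := exists_add_eq_of_isCompl hIJ y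
    rw [lie_add, hab x hx u hu, lie_eq_zero_of_isCompl hIJ hx hv, add_zero]
  have hDJ : (derivedAlgebra L).toSubmodule ≤ J.toSubmodule := by
    refine derivedAlgebra_le fun x y => ?_
    obtain ⟨u, hu, v, hv, rfl⟩ := exists_add_eq_of_isCompl hIJ x
    rw [add_lie, hI0 u hu, zero_add]
    exact lie_mem_left ℝ L J v y hv
  refine hI ((LieSubmodule.eq_bot_iff I).mpr fun x hx => ?_)
  have h : x ∈ I ⊓ J := ⟨hx, hDJ (hcen x (hI0 x hx))⟩
  rwa [hIJ.inf_eq_bot, LieSubmodule.mem_bot] at h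

/-- Otherwise both summands are non-abelian, and since the derived algebra is a plane, each
contributes one line of brackets. A functional `f` that is nonzero on both lines gives a skew form
`f [x, y]` whose radical contains a vector outside the plane. As `f` is injective on each line, this
vector commutes with both summands, a contradiction. -/
theorem exists_central_of_isReducibleLie (hL : Module.finrank ℝ L = 7) (hn : IsTwoStepNilpotent L)
    (hD : Module.finrank ℝ (derivedAlgebra L) = 2) (hred : IsReducibleLie L)
    {g : LinearMap.BilinForm ℝ L} (hg : IsInnerProduct g) :
    ∃ x : L, (∀ y : L, ⁅x, y⁆ = 0) ∧ x ∉ (derivedAlgebra L).toSubmodule := by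
  have : FiniteDimensional ℝ L := Module.finite_of_finrank_pos (by omega)
  by_contra! hcen
  obtain ⟨I, J, hI, hJ, hIJ⟩ := hred
  obtain ⟨x₁, hx₁, y₁, hy₁, h₁⟩ := exists_lie_ne_zero_of_isCompl hIJ hI hcen
  obtain ⟨x₂, hx₂, y₂, hy₂, h₂⟩ := exists_lie_ne_zero_of_isCompl hIJ.symm hJ hcen
  set D := (derivedAlgebra L).toSubmodule with hDdef
  replace hD : Module.finrank ℝ D = 2 := hD
  have hz₁ : ⁅x₁, y₁⁆ ∈ I := lie_mem_left ℝ L I x₁ y₁ hx₁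
  have hz₂ : ⁅x₂, y₂⁆ ∈ J := lie_mem_left ℝ L J x₂ y₂ hx₂
  have hdisj : ∀ z ∈ I, z ∈ J → z = 0 := by
    intro z hzI hzJ
    have h : z ∈ I ⊓ J := ⟨hzI, hzJ⟩
    rwa [hIJ.inf_eq_bot, LieSubmodule.mem_bot] at h
  have hli : LinearIndependent ℝ ![⁅x₁, y₁⁆, ⁅x₂, y₂⁆] := by
    rw [LinearIndependent.pair_iff]
    intro s t hst
    have hs : s • ⁅x₁, y₁⁆ = 0 := by
      refine hdisj _ (I.smul_mem s hz₁) ?_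
      rw [eq_neg_of_add_eq_zero_left hst]
      exact neg_mem (J.smul_mem t hz₂)
    rw [hs, zero_add] at hst
    exact ⟨(smul_eq_zero.mp hs).resolve_right h₁, (smul_eq_zero.mp hst).resolve_right h₂⟩
  have hspan : Submodule.span ℝ (Set.range ![⁅x₁, y₁⁆, ⁅x₂, y₂⁆]) = D := by
    refine Submodule.eq_of_le_of_finrank_eq ?_ ?_
    · rw [Submodule.span_le]
      rintro _ ⟨i, rfl⟩
      fin_cases i <;> exact lie_mem_derivedAlgebra _ _
    · rw [finrank_span_eq_card hli, hD, Fintype.card_fin]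
  have hdecomp : ∀ x y : L, ∃ s t : ℝ, ⁅x, y⁆ = s • ⁅x₁, y₁⁆ + t • ⁅x₂, y₂⁆ := by
    intro x y
    have h : ⁅x, y⁆ ∈ D := lie_mem_derivedAlgebra x y
    rw [← hspan, Matrix.range_cons, Matrix.range_cons, Matrix.range_empty, Set.union_empty,
      Set.singleton_union, Submodule.mem_span_pair] at h
    obtain ⟨s, t, h⟩ := h
    exact ⟨s, t, h.symm⟩
  have hbI : ∀ x ∈ I, ∀ y : L, ∃ s : ℝ, ⁅x, y⁆ = s • ⁅x₁, y₁⁆ := by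
    intro x hx y
    obtain ⟨s, t, h⟩ := hdecomp x y
    refine ⟨s, ?_⟩
    rw [h, add_eq_left]
    refine hdisj _ ?_ (J.smul_mem t hz₂)
    rw [← sub_eq_of_eq_add' h]
    exact sub_mem (lie_mem_left ℝ L I x y hx) (I.smul_mem s hz₁)
  have hbJ : ∀ x ∈ J, ∀ y : L, ∃ t : ℝ, ⁅x, y⁆ = t • ⁅x₂, y₂⁆ := by
    intro x hx y
    obtain ⟨s, t, h⟩ := hdecomp x y
    refine ⟨t, ?_⟩
    rw [h, add_eq_right]
    refine hdisj _ (I.smul_mem s hz₁) ?_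
    rw [← sub_eq_of_eq_add h]
    exact sub_mem (lie_mem_left ℝ L J x y hx) (J.smul_mem t hz₂)
  obtain ⟨f, hf₁, hf₂⟩ : ∃ f : L →ₗ[ℝ] ℝ, f ⁅x₁, y₁⁆ ≠ 0 ∧ f ⁅x₂, y₂⁆ ≠ 0 := by
    obtain ⟨f, hf, hfJ⟩ := Submodule.exists_le_ker_of_notMem (p := J.toSubmodule)
      (v := ⁅x₁, y₁⁆) fun h => h₁ (hdisj _ hz₁ h)
    obtain ⟨f', hf', hfI⟩ := Submodule.exists_le_ker_of_notMem (p := I.toSubmodule)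
      (v := ⁅x₂, y₂⁆) fun h => h₂ (hdisj _ h hz₂)
    have h12 : f ⁅x₂, y₂⁆ = 0 := hfJ hz₂
    have h21 : f' ⁅x₁, y₁⁆ = 0 := hfI hz₁
    exact ⟨f + f', by simpa [h21] using hf, by simpa [h12] using hf'⟩
  obtain ⟨e, -, heD, -⟩ := exists_orthonormalBasis_flag hg hL (le_refl D)
  rw [hD] at heD
  obtain ⟨x, hxD, hx⟩ := exists_radical_notMem hL
    (LinearMap.mk₂ ℝ (fun x y : L => f ⁅x, y⁆) (fun x y z => by rw [add_lie, map_add])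
      (fun c x y => by rw [smul_lie, map_smul]) (fun x y z => by rw [lie_add, map_add])
      (fun c x y => by rw [lie_smul, map_smul]))
    (fun x y => by
      change f ⁅x, y⁆ = -f ⁅y, x⁆
      rw [← lie_skew, map_neg]) hD heD fun d hd y => by
      change f ⁅d, y⁆ = 0
      rw [hn.lie_eq_zero d hd, map_zero]
  replace hx : ∀ y : L, f ⁅x, y⁆ = 0 := hx
  refine hxD (hcen x fun y => ?_)
  obtain ⟨u, hu, v, hv, rfl⟩ := exists_add_eq_of_isCompl hIJ y
  have hxu : ⁅x, u⁆ = 0 := by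
    obtain ⟨s, hs⟩ := hbI u hu x
    have h := hx u
    rw [← lie_skew, hs, map_neg, map_smul, smul_eq_mul, neg_eq_zero] at h
    rw [← lie_skew, hs, (mul_eq_zero.mp h).resolve_right hf₁, zero_smul, neg_zero]
  have hxv : ⁅x, v⁆ = 0 := by
    obtain ⟨t, ht⟩ := hbJ v hv x
    have h := hx v
    rw [← lie_skew, ht, map_neg, map_smul, smul_eq_mul, neg_eq_zero] at h
    rw [← lie_skew, ht, (mul_eq_zero.mp h).resolve_right hf₂, zero_smul, neg_zero]
  rw [lie_add, hxu, hxv, add_zero]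

theorem exists_coclosed_of_isReducibleLie (hL : Module.finrank ℝ L = 7) (hn : IsTwoStepNilpotent L)
    (hD : Module.finrank ℝ (derivedAlgebra L) = 2) (hred : IsReducibleLie L)
    {g : LinearMap.BilinForm ℝ L} (hg : IsInnerProduct g) :
    ∃ φ : KForm L 3, IsCoclosedG2Structure φ ∧ IsInducedMetric φ g := by
  have : FiniteDimensional ℝ L := Module.finite_of_finrank_pos (by omega)
  obtain ⟨x, hx, hxD⟩ := exists_central_of_isReducibleLie hL hn hD hred hg
  have hx0 : x ≠ 0 := fun h => hxD (h ▸ Submodule.zero_mem _)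
  refine exists_coclosed_of_central_three hL hg
    (C := (derivedAlgebra L).toSubmodule ⊔ Submodule.span ℝ {x})
    (fun y z => Submodule.mem_sup_left (lie_mem_derivedAlgebra y z)) (fun c hc y => ?_) ?_
  · obtain ⟨d, hd, w, hw, rfl⟩ := Submodule.mem_sup.mp hc
    obtain ⟨t, rfl⟩ := Submodule.mem_span_singleton.mp hw
    rw [add_lie, hn.lie_eq_zero d hd, smul_lie, hx, smul_zero, add_zero]
  · have h1 := Submodule.finrank_sup_add_finrank_inf_eq (derivedAlgebra L).toSubmodule
      (Submodule.span ℝ {x})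
    rw [(Submodule.disjoint_span_singleton' hx0).mpr hxD |>.eq_bot, finrank_span_singleton hx0,
      finrank_bot, add_zero] at h1
    exact h1.trans (congrArg (· + 1) hD)

theorem IsTwoStepNilpotent.finrank_derivedAlgebra_pos (hL : Module.finrank ℝ L = 7)
    (hn : IsTwoStepNilpotent L) : 0 < Module.finrank ℝ (derivedAlgebra L) := by
  have : FiniteDimensional ℝ L := Module.finite_of_finrank_pos (by omega)
  rw [Nat.pos_iff_ne_zero]
  intro h
  have hbot : (derivedAlgebra L).toSubmodule = ⊥ := Submodule.finrank_eq_zero.mp h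
  refine hn.1 ⟨fun x y => ?_⟩
  have hxy := lie_mem_derivedAlgebra x y
  rwa [hbot, Submodule.mem_bot] at hxy

/-- If four basis vectors were central, the other three would produce only three independent
brackets at most. -/
theorem IsTwoStepNilpotent.finrank_derivedAlgebra_le (hL : Module.finrank ℝ L = 7)
    (hn : IsTwoStepNilpotent L) {g : LinearMap.BilinForm ℝ L} (hg : IsInnerProduct g) :
    Module.finrank ℝ (derivedAlgebra L) ≤ 3 := by
  have : FiniteDimensional ℝ L := Module.finite_of_finrank_pos (by omega)
  by_contra! h4
  set D := (derivedAlgebra L).toSubmodule with hDdef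
  replace h4 : 3 < Module.finrank ℝ D := h4
  obtain ⟨e, -, heD, -⟩ := exists_orthonormalBasis_flag hg hL (le_refl D)
  have h0 : ∀ i : Fin 7, i.val < 4 → ∀ y : L, ⁅e i, y⁆ = 0 := fun i hi =>
    hn.lie_eq_zero _ (heD i (by omega))
  have h0' : ∀ i : Fin 7, i.val < 4 → ∀ y : L, ⁅y, e i⁆ = 0 := fun i hi y => by
    rw [← lie_skew, h0 i hi, neg_zero]
  set S := Submodule.span ℝ (Set.range ![⁅e 4, e 5⁆, ⁅e 4, e 6⁆, ⁅e 5, e 6⁆]) with hS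
  have h45 : ⁅e 4, e 5⁆ ∈ S := Submodule.subset_span ⟨0, rfl⟩
  have h46 : ⁅e 4, e 6⁆ ∈ S := Submodule.subset_span ⟨1, rfl⟩
  have h56 : ⁅e 5, e 6⁆ ∈ S := Submodule.subset_span ⟨2, rfl⟩
  have hcase : ∀ i : Fin 7, i.val < 4 ∨ i = 4 ∨ i = 5 ∨ i = 6 := by decide
  have hbasis : ∀ i j, ⁅e i, e j⁆ ∈ S := by
    have hskew : ∀ i j, ⁅e i, e j⁆ ∈ S → ⁅e j, e i⁆ ∈ S := fun i j h => by
      rw [← lie_skew]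
      exact neg_mem h
    intro i j
    rcases hcase i with hi | hi
    · rw [h0 i hi]
      exact S.zero_mem
    rcases hcase j with hj | hj
    · rw [h0' j hj]
      exact S.zero_mem
    have hself : ∀ i, ⁅e i, e i⁆ ∈ S := fun i => by rw [lie_self]; exact S.zero_mem
    rcases hi with rfl | rfl | rfl <;> rcases hj with rfl | rfl | rfl <;>
      first | assumption | exact hself _ | exact hskew _ _ (by assumption)
  have hDS : D ≤ S := by
    refine derivedAlgebra_le fun x y => ?_
    rw [← e.sum_repr x, ← e.sum_repr y]
    simp only [sum_lie, lie_sum, smul_lie, lie_smul, Finset.smul_sum]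
    exact Submodule.sum_mem _ fun i _ => Submodule.sum_mem _ fun j _ =>
      S.smul_mem _ (S.smul_mem _ (hbasis _ _))
  have h1 := Submodule.finrank_mono hDS
  have h2 : Module.finrank ℝ S ≤ 3 := (finrank_range_le_card _).trans_eq (Fintype.card_fin 3)
  omega

end Dimension

theorem theorem1p1 {n : Type*} [LieRing n] [LieAlgebra ℝ n]
    (hdim : Module.finrank ℝ n = 7) (hn : IsTwoStepNilpotent n) :
    (¬ IsReducibleLie n → Module.finrank ℝ (derivedAlgebra n) = 2 →
      ¬ ∃ φ : KForm n 3, IsCoclosedG2Structure φ) ∧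
    (IsReducibleLie n ∨ Module.finrank ℝ (derivedAlgebra n) ≠ 2 →
      ∀ g : LinearMap.BilinForm ℝ n, IsInnerProduct g →
        ∃ φ : KForm n 3, IsCoclosedG2Structure φ ∧ IsInducedMetric φ g) := by
  refine ⟨fun hirr hD ⟨φ, hφ⟩ => ?_, fun h g hg => ?_⟩
  · obtain ⟨x, hx, hxD⟩ := exists_central_of_coclosed hdim hn hD hφ
    exact hirr (IsReducibleLie.of_central hx hxD hn.1)
  · have hpos := hn.finrank_derivedAlgebra_pos hdim
    have hle := hn.finrank_derivedAlgebra_le hdim hg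
    by_cases h2 : Module.finrank ℝ (derivedAlgebra n) = 2
    · exact exists_coclosed_of_isReducibleLie hdim hn h2 (h.resolve_right fun h' => h' h2) hg
    obtain h1 | h3 : Module.finrank ℝ (derivedAlgebra n) = 1 ∨
        Module.finrank ℝ (derivedAlgebra n) = 3 := by omega
    · exact exists_coclosed_of_central_one hdim hg lie_mem_derivedAlgebra hn.lie_eq_zero h1
    · exact exists_coclosed_of_central_three hdim hg lie_mem_derivedAlgebra hn.lie_eq_zero h3
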